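/- Let $l,g\in\mathbb R$, $\gamma>1$, $\mu=\mu(x_3)$, and let $J$ be a nondegenerate time interval containing $0$. Let $\rho\ge 0$, $p\ge0$, $U$ be a classical ($C^1$) solution of $$\rho(\partial_tU+(U,\nabla)U+l\,e_3\times U+\mu U_H+g e_3)=-\nabla p,\qquad \partial_t\rho+\mathrm{div}(\rho U)=0,\qquad \partial_tp+(U,\nabla p)+\gamma p\,\mathrm{div}\,U=0$$ in a material volume $\Omega(t)\subset\mathbb R^3$, $t\in J$ (the open region swept by it is transported by the flow of $U$), where $U_H=(U_1,U_2,0)$, and suppose that in $\Omega(t)$ $$U=(a_Hx_1+b_Hx_2,\;c_Hx_1+d_Hx_2,\;0),\qquad a_H,b_H,c_H,d_H \text{ depending on } (t,x_3).$$ Fix $x_3$, let $\Omega_H(t)$ be the section of $\Omega(t)$ at height $x_3$, and put $$G_{x_1}=\tfrac12\int_{\Omega_H(t)}\rho x_1^2,\quad G_{x_2}=\tfrac12\int_{\Omega_H(t)}\rho x_2^2,\quad G_{x_1x_2}=\tfrac12\int_{\Omega_H(t)}\rho x_1x_2,\quad \Delta=G_{x_1}G_{x_2}-G_{x_1x_2}^2,\quad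 E_p=\tfrac1{\gamma-1}\int_{\Omega_H(t)}p ,$$ where the integrals are over $(x_1,x_2)$, and $\rho(x_1^2+x_2^2)$ and $p$ are assumed integrable over $\Omega_H(0)$. (i) For all $t\in J$ the functions $\rho(x_1^2+x_2^2)$ and $p$ are integrable over $\Omega_H(t)$, and $$\partial_tG_{x_1}=2a_HG_{x_1}+2b_HG_{x_1x_2},\quad \partial_tG_{x_2}=2d_HG_{x_2}+2c_HG_{x_1x_2},\quad \partial_tG_{x_1x_2}=(a_H+d_H)G_{x_1x_2}+b_HG_{x_2}+c_HG_{x_1},$$ $$\partial_tE_p=-(\gamma-1)(a_H+d_H)E_p,\qquad \partial_t\Delta=2(a_H+d_H)\Delta .$$ (ii) If $\rho(0,\cdot)$ does not vanish identically on $\Omega_H(0)$, then $\Delta(t)>0$ and $E_p(t)=E_p(0)\,\Delta(0)^{(\gamma-1)/2}\,\Delta(t)^{(1-\gamma)/2}$ for all $t\in J$. (iii) If, in addition to the assumption of (ii), $p$ tends to $0$ at the boundary of $\Omega_H(t)$ for every $t\in J$, then the functions $G_1=G_{x_1}\Delta^{-(\gamma+1)/2}$, $G_2=G_{x_2}\Delta^{-(\gamma+1)/2}$,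 $G_3=G_{x_1x_2}\Delta^{-(\gamma+1)/2}$ and $a_H,b_H,c_H,d_H$ satisfy on $J$, with $\mathcal K=\frac{\gamma-1}2E_p\Delta^{(\gamma-1)/2}|_{t=0}$ and $\mu=\mu(x_3)$, the closed system $$\begin{aligned} \partial_tG_1&=((1-\gamma)a_H-(1+\gamma)d_H)G_1+2b_HG_3,\\ \partial_tG_2&=((1-\gamma)d_H-(1+\gamma)a_H)G_2+2c_HG_3,\\ \partial_tG_3&=c_HG_1+b_HG_2-\gamma(a_H+d_H)G_3,\\ \partial_ta_H&=-a_H^2-b_Hc_H+lc_H-\mu a_H+\mathcal KG_2,\\ \partial_tb_H&=-b_H(a_H+d_H)+ld_H-\mu b_H-\mathcal KG_3,\\ \partial_tc_H&=-c_H(a_H+d_H)-la_H-\mu c_H-\mathcal KG_3,\\ \partial_td_H&=-d_H^2-b_Hc_H-lb_H-\mu d_H+\mathcal KG_1. \end{aligned}$$ (iv) For arbitrary real functions $a,b,c,d,G_1,G_2,G_3$ on $J$ and constants $\mu,\mathcal K$, this system (with $a,b,c,d$ in place of $a_H,b_H,c_H,d_H$) coincides with the system of exact solutions of the two-dimensional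 barotropic model under the substitution $2c_0=\mathcal K$, $A=-G_2$, $B=2G_3$, $C=-G_1$. That is, it is equivalent to $$\dot R+RQ+Q^TR+(\gamma-1)(\mathrm{tr}\,Q)R=0,\qquad \dot Q+Q^2+lLQ+\mu Q+2c_0R=0,$$ $$Q=\begin{pmatrix}a&b\\c&d\end{pmatrix},\quad R=\begin{pmatrix}A&\frac12B\\\frac12B&C\end{pmatrix},\quad L=\begin{pmatrix}0&-1\\1&0\end{pmatrix},$$ and also to the statement that $\mathbf U=Q\mathbf x$, $\pi=Ax_1^2+Bx_1x_2+Cx_2^2$ satisfy, for all $\mathbf x\in\mathbb R^2$, $t\in J$, $$\partial_t\mathbf U+(\mathbf U\cdot\nabla)\mathbf U+(lL+\mu I)\mathbf U+c_0\nabla\pi=0,\qquad \partial_t\pi+\nabla\pi\cdot\mathbf U+(\gamma-1)\pi\,\mathrm{div}\,\mathbf U=0 .$$ -/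

import Mathlib

open MeasureTheory Filter Topology Set

noncomputable section

namespace Vortex

/-- Points and vectors of the three-dimensional physical space, in coordinates
`x 0, x 1, x 2` for `x₁, x₂, x₃`. -/
abbrev Space := Fin 3 → ℝ

/-- Points and vectors of the horizontal plane. -/
abbrev Plane := Fin 2 → ℝ

/-- The unit vector `e₃`. -/
def e3 : Space := ![0, 0, 1]

/-- The point of space above `y` at height `z`. -/
def lift (y : Plane) (z : ℝ) : Space := ![y 0, y 1, z]

/-- The horizontal part `(v₁, v₂, 0)` of a vector. -/
def horizontal (v : Space) : Space := ![v 0, v 1, 0]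

/-- Gradient of a scalar function of `n` real variables. -/
def grad {n : ℕ} (f : (Fin n → ℝ) → ℝ) (x : Fin n → ℝ) : Fin n → ℝ :=
  fun i => fderiv ℝ f x (Pi.single i 1)

/-- Divergence of a vector field of `n` real variables. -/
def divg {n : ℕ} (V : (Fin n → ℝ) → (Fin n → ℝ)) (x : Fin n → ℝ) : ℝ :=
  ∑ i, fderiv ℝ (fun y => V y i) x (Pi.single i 1)

/-- The space-time region swept by a family of sets `Ω t`, `t ∈ J`. -/
def spaceTime (J : Set ℝ) (Ω : ℝ → Set Space) : Set (ℝ × Space) :=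
  {q | q.1 ∈ J ∧ q.2 ∈ Ω q.1}

/-- `Ω t`, `t ∈ J`, is an (open) material volume for the velocity field `U`: it consists at time
`t` of the positions of the fluid particles that were in `Ω 0` at time `0`; `φ · y` is the
trajectory of the particle that starts at `y`. Openness is relative to the time interval `J`. -/
structure IsMaterialVolume (J : Set ℝ) (U : ℝ → Space → Space) (Ω : ℝ → Set Space) : Prop where
  isOpen : ∃ O : Set (ℝ × Space), IsOpen O ∧ spaceTime J Ω = O ∩ (J ×ˢ univ)
  flow : ∃ φ : ℝ → Space → Space,
    (∀ y ∈ Ω 0, φ 0 y = y) ∧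
    (∀ y ∈ Ω 0, ∀ t ∈ J, HasDerivWithinAt (fun s => φ s y) (U t (φ t y)) J t) ∧
    (∀ t ∈ J, Ω t = φ t '' Ω 0)

/-- `ρ, p, U` is a classical solution inside `Ω t`, `t ∈ J`, of the equations of gas dynamics in a
rotating frame (Coriolis parameter `l`, gravity `g`) with linear horizontal friction whose
coefficient `μ` depends on the height: balance of momentum, conservation of mass and the
equation for the pressure with adiabatic exponent `γ`. -/
structure IsClassicalSolution (γ l g : ℝ) (μ : ℝ → ℝ) (J : Set ℝ) (Ω : ℝ → Set Space)
    (ρ p : ℝ → Space → ℝ) (U : ℝ → Space → Space) : Prop where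
  density_contDiffOn : ContDiffOn ℝ 1 (fun q : ℝ × Space => ρ q.1 q.2) (spaceTime J Ω)
  pressure_contDiffOn : ContDiffOn ℝ 1 (fun q : ℝ × Space => p q.1 q.2) (spaceTime J Ω)
  velocity_contDiffOn : ContDiffOn ℝ 1 (fun q : ℝ × Space => U q.1 q.2) (spaceTime J Ω)
  density_nonneg : ∀ t ∈ J, ∀ x ∈ Ω t, 0 ≤ ρ t x
  pressure_nonneg : ∀ t ∈ J, ∀ x ∈ Ω t, 0 ≤ p t x
  momentum : ∀ t ∈ J, ∀ x ∈ Ω t,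
    ρ t x • (derivWithin (fun s => U s x) J t + fderiv ℝ (U t) x (U t x)
      + l • crossProduct e3 (U t x) + μ (x 2) • horizontal (U t x) + g • e3)
      = -grad (p t) x
  mass : ∀ t ∈ J, ∀ x ∈ Ω t,
    derivWithin (fun s => ρ s x) J t + divg (fun y => ρ t y • U t y) x = 0
  pressure : ∀ t ∈ J, ∀ x ∈ Ω t,
    derivWithin (fun s => p s x) J t + fderiv ℝ (p t) x (U t x) + γ * p t x * divg (U t) x = 0

/-- The matrix with rows `(a, b)` and `(c, d)`. -/
def mat (a b c d : ℝ) : Matrix (Fin 2) (Fin 2) ℝ := !![a, b; c, d]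

/-- Inside `Ω t` the vertical velocity vanishes and the horizontal velocity is linear in
`(x₁, x₂)`, with coefficients that depend on time and height. -/
def HasLinearProfile (J : Set ℝ) (Ω : ℝ → Set Space) (U : ℝ → Space → Space)
    (a b c d : ℝ → ℝ → ℝ) : Prop :=
  ∀ t ∈ J, ∀ x ∈ Ω t,
    U t x = ![a t (x 2) * x 0 + b t (x 2) * x 1, c t (x 2) * x 0 + d t (x 2) * x 1, 0]

/-- The horizontal section of `W` at height `z`. -/
def slice (W : Set Space) (z : ℝ) : Set Plane := {y | lift y z ∈ W}

section Functionals

variable (Ω : ℝ → Set Space) (ρ p : ℝ → Space → ℝ) (γ t z : ℝ)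

/-- `G_{x₁}(t, z)`. -/
def Gx1 : ℝ := 1 / 2 * ∫ y in slice (Ω t) z, ρ t (lift y z) * y 0 ^ 2

/-- `G_{x₂}(t, z)`. -/
def Gx2 : ℝ := 1 / 2 * ∫ y in slice (Ω t) z, ρ t (lift y z) * y 1 ^ 2

/-- `G_{x₁x₂}(t, z)`. -/
def Gx1x2 : ℝ := 1 / 2 * ∫ y in slice (Ω t) z, ρ t (lift y z) * (y 0 * y 1)

/-- `Δ(t, z)`. -/
def Delta : ℝ := Gx1 Ω ρ t z * Gx2 Ω ρ t z - Gx1x2 Ω ρ t z ^ 2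

/-- The potential energy `E_p(t, z)`. -/
def Ep : ℝ := 1 / (γ - 1) * ∫ y in slice (Ω t) z, p t (lift y z)

/-- `G₁(t, z)`. -/
def G1 : ℝ := Gx1 Ω ρ t z * Delta Ω ρ t z ^ (-(γ + 1) / 2)

/-- `G₂(t, z)`. -/
def G2 : ℝ := Gx2 Ω ρ t z * Delta Ω ρ t z ^ (-(γ + 1) / 2)

/-- `G₃(t, z)`. -/
def G3 : ℝ := Gx1x2 Ω ρ t z * Delta Ω ρ t z ^ (-(γ + 1) / 2)

/-- The second moments of the density and the integral of the pressure over the section at height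
`z` converge at time `t`. -/
def FiniteMoments : Prop :=
  IntegrableOn (fun y : Plane => ρ t (lift y z) * (y 0 ^ 2 + y 1 ^ 2)) (slice (Ω t) z) ∧
  IntegrableOn (fun y : Plane => p t (lift y z)) (slice (Ω t) z)

end Functionals

/-- The constant `K = (γ - 1) / 2 * E_p * Δ ^ ((γ - 1) / 2)`, taken at time `0`, at height `z`. -/
def Kconst (Ω : ℝ → Set Space) (ρ p : ℝ → Space → ℝ) (γ z : ℝ) : ℝ :=
  (γ - 1) / 2 * Ep Ω p γ 0 z * Delta Ω ρ 0 z ^ ((γ - 1) / 2)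

/-- The pressure tends to zero at the boundary of the section at height `z`, at all times. -/
def PressureVanishesOnBoundary (J : Set ℝ) (Ω : ℝ → Set Space) (p : ℝ → Space → ℝ) (z : ℝ) :
    Prop :=
  ∀ t ∈ J, ∀ y ∈ frontier (slice (Ω t) z),
    Tendsto (fun y' : Plane => p t (lift y' z)) (𝓝[slice (Ω t) z] y) (𝓝 0)

/-- The closed system of seven ordinary differential equations, on the time interval `J`. -/
structure SolvesFullSystem (γ l κ K : ℝ) (J : Set ℝ) (g₁ g₂ g₃ a b c d : ℝ → ℝ) : Prop where
  eq_g₁ : ∀ t ∈ J, HasDerivWithinAt g₁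
    (((1 - γ) * a t - (1 + γ) * d t) * g₁ t + 2 * b t * g₃ t) J t
  eq_g₂ : ∀ t ∈ J, HasDerivWithinAt g₂
    (((1 - γ) * d t - (1 + γ) * a t) * g₂ t + 2 * c t * g₃ t) J t
  eq_g₃ : ∀ t ∈ J, HasDerivWithinAt g₃
    (c t * g₁ t + b t * g₂ t - γ * (a t + d t) * g₃ t) J t
  eq_a : ∀ t ∈ J, HasDerivWithinAt a
    (-a t ^ 2 - b t * c t + l * c t - κ * a t + K * g₂ t) J t
  eq_b : ∀ t ∈ J, HasDerivWithinAt b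
    (-b t * (a t + d t) + l * d t - κ * b t - K * g₃ t) J t
  eq_c : ∀ t ∈ J, HasDerivWithinAt c
    (-c t * (a t + d t) - l * a t - κ * c t - K * g₃ t) J t
  eq_d : ∀ t ∈ J, HasDerivWithinAt d
    (-d t ^ 2 - b t * c t - l * b t - κ * d t + K * g₁ t) J t

/-- The matrix `L` of the rotation by a right angle. -/
def rot : Matrix (Fin 2) (Fin 2) ℝ := !![0, -1; 1, 0]

/-- The two-dimensional barotropic system for the velocity `V` and `π = P ^ ((γ - 1) / γ)`, with
Coriolis parameter `l`, friction coefficient `κ` and constant `c₀`, on the whole plane. -/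
def SolvesBarotropic (γ l κ c₀ : ℝ) (J : Set ℝ) (V : ℝ → Plane → Plane) (π : ℝ → Plane → ℝ) :
    Prop :=
  ∀ t ∈ J, Differentiable ℝ (V t) ∧ Differentiable ℝ (π t) ∧ ∀ x : Plane,
    HasDerivWithinAt (fun s => V s x)
      (-(fderiv ℝ (V t) x (V t x) + (l • rot + κ • (1 : Matrix (Fin 2) (Fin 2) ℝ)).mulVec (V t x)
        + c₀ • grad (π t) x)) J t ∧
    HasDerivWithinAt (fun s => π s x)
      (-(fderiv ℝ (π t) x (V t x) + (γ - 1) * π t x * divg (V t) x)) J t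

/-- The matrix system `R' + R Q + Qᵀ R + (γ - 1) (tr Q) R = 0`,
`Q' + Q² + l L Q + κ Q + 2 c₀ R = 0`, understood entrywise. -/
def SolvesMatrixSystem (γ l κ c₀ : ℝ) (J : Set ℝ) (Q R : ℝ → Matrix (Fin 2) (Fin 2) ℝ) : Prop :=
  ∀ t ∈ J, ∀ i j,
    HasDerivWithinAt (fun s => R s i j)
      ((-(R t * Q t + (Q t).transpose * R t + ((γ - 1) * (Q t).trace) • R t)) i j) J t ∧
    HasDerivWithinAt (fun s => Q s i j)
      ((-(Q t * Q t + l • (rot * Q t) + κ • Q t + (2 * c₀) • R t)) i j) J t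

end Vortex

end

/-! Since the vertical velocity is zero, particles stay at their height, and in the section at
height `z` every trajectory solves the same linear equation `x' = Q x`, with `Q` the matrix of the
coefficients. So the flow of the section is a family of matrices `M t` with `M' = Q M`, `M 0 = 1`
and `det M > 0` (`exists_isLinearFlow`). Along trajectories the equations for density and pressure
say that `det M * ρ` and `(det M) ^ γ * p` are constant (`density_transport`, `pressure_transport`).
Changing variables by `M t` then expresses the second moments at time `t` through those at time `0`
with coefficients quadratic in the entries of `M t`, and gives `E_p` the factor `(det M) ^ (1 - γ)`
(`functionals_transport`). The moment equations follow by differentiating these formulas, without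
differentiating under the integral sign. As `Δ` is multiplied by `(det M) ^ 2`, eliminating `det M`
gives the relation between `E_p` and `Δ`.

For the velocity coefficients, the horizontal momentum equations on the section have the form `∂ᵢ p
= -ρ (β₀ x₁ + β₁ x₂)`, where `β₀, β₁` contain the time derivatives of the coefficients. Multiplying
by `x_j` and integrating by parts, with `p = 0` at the boundary, gives linear systems for `β₀, β₁`
whose matrix is made of the second moments and whose right-hand sides are `0` or `∫ p`
(`momentum_moments`). Since `Δ > 0` they are solved by Cramer's rule, and `∫ p` is eliminated by the
relation between `E_p` and `Δ` (`coeff_system`). The delicate point is the integration by parts over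
an arbitrary, possibly unbounded, open set (`setIntegral_coord_mul_fderiv`).

The equivalence with the barotropic model is a comparison of matrix entries and of polynomial
coefficients in `x`. -/

namespace Vortex

/-! ### Equivalence with the two-dimensional barotropic system. -/

section ExactSolutions

/-- The equation for `R` preserves symmetry, so its two off-diagonal entries are the same equation
for `g₃`; the eight entries therefore amount to seven scalar equations. -/
theorem solvesFullSystem_iff_solvesMatrixSystem (γ l κ K : ℝ) (J : Set ℝ)
    (g₁ g₂ g₃ α β η δ : ℝ → ℝ) :
    SolvesFullSystem γ l κ K J g₁ g₂ g₃ α β η δ ↔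
      SolvesMatrixSystem γ l κ (K / 2) J (fun t => mat (α t) (β t) (η t) (δ t))
        (fun t => mat (-g₂ t) (g₃ t) (g₃ t) (-g₁ t)) := by
  constructor
  · intro h t ht i j
    fin_cases i <;> fin_cases j <;>
      simp only [mat, rot, Matrix.neg_apply, Matrix.add_apply, Matrix.mul_apply, Fin.sum_univ_two,
        Matrix.smul_apply, Matrix.transpose_apply, Matrix.trace_fin_two, smul_eq_mul,
        Matrix.of_apply, Matrix.cons_val', Matrix.cons_val_zero, Matrix.cons_val_one,
        Fin.zero_eta, Fin.mk_one, Fin.isValue, Matrix.cons_val_fin_one]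
    · exact ⟨(h.eq_g₂ t ht).neg.congr_deriv (by ring), (h.eq_a t ht).congr_deriv (by ring)⟩
    · exact ⟨(h.eq_g₃ t ht).congr_deriv (by ring), (h.eq_b t ht).congr_deriv (by ring)⟩
    · exact ⟨(h.eq_g₃ t ht).congr_deriv (by ring), (h.eq_c t ht).congr_deriv (by ring)⟩
    · exact ⟨(h.eq_g₁ t ht).neg.congr_deriv (by ring), (h.eq_d t ht).congr_deriv (by ring)⟩
  · intro h
    have h' : ∀ t ∈ J, _ := fun t ht => And.intro (h t ht 0 0)
      (And.intro (h t ht 0 1) (And.intro (h t ht 1 0) (h t ht 1 1)))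
    simp only [mat, rot, Matrix.neg_apply, Matrix.add_apply, Matrix.mul_apply, Fin.sum_univ_two,
        Matrix.smul_apply, Matrix.transpose_apply, Matrix.trace_fin_two, smul_eq_mul,
        Matrix.of_apply, Matrix.cons_val', Matrix.cons_val_zero, Matrix.cons_val_one,
        Fin.isValue, Matrix.cons_val_fin_one] at h'
    refine ⟨fun t ht => ?_, fun t ht => ?_, fun t ht => ?_, fun t ht => ?_, fun t ht => ?_,
      fun t ht => ?_, fun t ht => ?_⟩ <;>
      obtain ⟨⟨h1, h2⟩, ⟨h3, h4⟩, ⟨h5, h6⟩, h7, h8⟩ := h' t ht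
    · have := h7.neg
      simp only [Pi.neg_def, neg_neg] at this
      exact this.congr_deriv (by ring)
    · have := h1.neg
      simp only [Pi.neg_def, neg_neg] at this
      exact this.congr_deriv (by ring)
    · exact h3.congr_deriv (by ring)
    · exact h2.congr_deriv (by ring)
    · exact h4.congr_deriv (by ring)
    · exact h6.congr_deriv (by ring)
    · exact h8.congr_deriv (by ring)

/-- The derivative of the `i`-th coordinate function. -/
theorem hasFDerivAt_coord {n : ℕ} (i : Fin n) (x : Fin n → ℝ) :
    HasFDerivAt (fun y : Fin n → ℝ => y i)
      (ContinuousLinearMap.proj (R := ℝ) (φ := fun _ : Fin n => ℝ) i) x :=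
  (ContinuousLinearMap.proj (R := ℝ) (φ := fun _ : Fin n => ℝ) i).hasFDerivAt

theorem hasFDerivAt_mulVec (A : Matrix (Fin 2) (Fin 2) ℝ) (x : Plane) :
    HasFDerivAt (fun y : Plane => A.mulVec y) (LinearMap.toContinuousLinearMap A.mulVecLin) x :=
  (LinearMap.toContinuousLinearMap A.mulVecLin).hasFDerivAt

theorem fderiv_mulVec (A : Matrix (Fin 2) (Fin 2) ℝ) (x v : Plane) :
    fderiv ℝ (fun y : Plane => A.mulVec y) x v = A.mulVec v := by
  rw [(hasFDerivAt_mulVec A x).fderiv]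
  rfl

theorem divg_mulVec (A : Matrix (Fin 2) (Fin 2) ℝ) (x : Plane) :
    divg (fun y : Plane => A.mulVec y) x = A.trace := by
  have h : ∀ i : Fin 2, fderiv ℝ (fun y : Plane => A.mulVec y i) x (Pi.single i 1) = A i i := by
    intro i
    rw [((hasFDerivAt_pi'.1 (hasFDerivAt_mulVec A x)) i).fderiv]
    simp
  simp only [divg, h]
  rfl

theorem hasFDerivAt_quadratic (A B C : ℝ) (x : Plane) :
    HasFDerivAt (fun y : Plane => A * y 0 ^ 2 + B * (y 0 * y 1) + C * y 1 ^ 2)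
      ((2 * A * x 0 + B * x 1) •
          (ContinuousLinearMap.proj (R := ℝ) (φ := fun _ : Fin 2 => ℝ) 0) +
        (B * x 0 + 2 * C * x 1) •
          (ContinuousLinearMap.proj (R := ℝ) (φ := fun _ : Fin 2 => ℝ) 1)) x := by
  have h0 := hasFDerivAt_coord (n := 2) 0 x
  have h1 := hasFDerivAt_coord (n := 2) 1 x
  refine ((((h0.pow 2).const_mul A).add ((h0.mul h1).const_mul B)).add
    ((h1.pow 2).const_mul C)).congr_fderiv ?_
  ext v
  simp
  ring

theorem grad_quadratic (A B C : ℝ) (x : Plane) :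
    grad (fun y : Plane => A * y 0 ^ 2 + B * (y 0 * y 1) + C * y 1 ^ 2) x =
      ![2 * A * x 0 + B * x 1, B * x 0 + 2 * C * x 1] := by
  ext i
  rw [grad, (hasFDerivAt_quadratic A B C x).fderiv]
  fin_cases i <;> simp

/-- Both sides of the barotropic equations are linear (velocity) or quadratic (`π`) forms in `x`, so
they hold for all `x` exactly when the coefficients agree. -/
theorem solvesFullSystem_iff_solvesBarotropic (γ l κ K : ℝ) (J : Set ℝ)
    (g₁ g₂ g₃ α β η δ : ℝ → ℝ) :
    SolvesFullSystem γ l κ K J g₁ g₂ g₃ α β η δ ↔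
      SolvesBarotropic γ l κ (K / 2) J
        (fun t x => (mat (α t) (β t) (η t) (δ t)).mulVec x)
        (fun t x => -g₂ t * x 0 ^ 2 + 2 * g₃ t * (x 0 * x 1) + -g₁ t * x 1 ^ 2) := by
  have hdiff : ∀ t, Differentiable ℝ (fun x : Plane => (mat (α t) (β t) (η t) (δ t)).mulVec x) ∧
      Differentiable ℝ (fun x : Plane =>
        -g₂ t * x 0 ^ 2 + 2 * g₃ t * (x 0 * x 1) + -g₁ t * x 1 ^ 2) := fun t =>
    ⟨fun x => (hasFDerivAt_mulVec _ x).differentiableAt,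
      fun x => (hasFDerivAt_quadratic _ _ _ x).differentiableAt⟩
  unfold SolvesBarotropic
  simp only [hdiff, true_and, fderiv_mulVec, divg_mulVec, grad_quadratic,
    (hasFDerivAt_quadratic _ _ _ _).fderiv,
    hasDerivWithinAt_pi, Fin.forall_fin_two]
  simp only [mat, rot, Pi.neg_apply, Pi.add_apply, Matrix.add_mulVec, Matrix.smul_mulVec,
    Matrix.one_mulVec, Matrix.mulVec, dotProduct, Pi.smul_apply, Fin.sum_univ_two,
    Matrix.trace_fin_two, smul_eq_mul, Matrix.of_apply, Matrix.cons_val', Matrix.cons_val_zero,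
    Matrix.cons_val_one, Fin.isValue, Matrix.cons_val_fin_one, add_apply,
    smul_apply, ContinuousLinearMap.proj_apply]
  constructor
  · intro h t ht x
    refine ⟨⟨?_, ?_⟩, ?_⟩
    · exact (((h.eq_a t ht).mul_const (x 0)).add ((h.eq_b t ht).mul_const (x 1))).congr_deriv
        (by ring)
    · exact (((h.eq_c t ht).mul_const (x 0)).add ((h.eq_d t ht).mul_const (x 1))).congr_deriv
        (by ring)
    · exact (((((h.eq_g₂ t ht).neg).mul_const (x 0 ^ 2)).add
        (((h.eq_g₃ t ht).const_mul 2).mul_const (x 0 * x 1))).add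
        (((h.eq_g₁ t ht).neg).mul_const (x 1 ^ 2))).congr_deriv (by ring)
  · intro h
    -- A quadratic form in two variables is determined by its values at these three points, a linear
    -- one by the first two.
    have h' : ∀ t ∈ J, _ := fun t ht => And.intro (h t ht ![1, 0])
      (And.intro (h t ht ![0, 1]) (h t ht ![1, 1]))
    simp only [Matrix.cons_val_zero, Matrix.cons_val_one, Matrix.cons_val_fin_one, mul_one,
      mul_zero, add_zero, zero_add, one_pow, ne_eq, OfNat.ofNat_ne_zero, not_false_eq_true,
      zero_pow] at h'
    refine ⟨fun t ht => ?_, fun t ht => ?_, fun t ht => ?_, fun t ht => ?_, fun t ht => ?_,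
      fun t ht => ?_, fun t ht => ?_⟩ <;>
      obtain ⟨⟨⟨ha, hc⟩, h2⟩, ⟨⟨hb, hd⟩, h1⟩, -, h3⟩ := h' t ht
    · have := h1.neg
      simp only [Pi.neg_def, neg_neg] at this
      exact this.congr_deriv (by ring)
    · have := h2.neg
      simp only [Pi.neg_def, neg_neg] at this
      exact this.congr_deriv (by ring)
    -- Polarization: `π(1,1) - π(1,0) - π(0,1) = 2 g₃`.
    · have := ((h3.sub h2).sub h1).const_mul (1 / 2)
      refine (this.congr_deriv ?_).congr_of_eventuallyEq (.of_forall fun s => ?_) ?_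
      · ring
      · simp only [Pi.sub_apply]; ring
      · simp only [Pi.sub_apply]; ring
    · exact ha.congr_deriv (by ring)
    · exact hb.congr_deriv (by ring)
    · exact hc.congr_deriv (by ring)
    · exact hd.congr_deriv (by ring)

end ExactSolutions

/-! ### Calculus on the time interval and on the space-time region. -/

section MaterialDerivative

theorem uniqueDiffOn_of_ordConnected_of_nontrivial {J : Set ℝ} (hJ : J.OrdConnected)
    (hJ' : J.Nontrivial) : UniqueDiffOn ℝ J := by
  obtain ⟨x, hx, y, hy, hxy⟩ := hJ'.exists_lt
  refine uniqueDiffOn_convex hJ.convex ⟨(x + y) / 2, ?_⟩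
  refine mem_interior.2 ⟨Ioo x y, fun s hs => hJ.out hx hy (Ioo_subset_Icc_self hs), isOpen_Ioo, ?_⟩
  constructor <;> linarith

theorem eq_of_hasDerivWithinAt_zero {J : Set ℝ} (hJ : J.OrdConnected) {f : ℝ → ℝ}
    (hf : ∀ t ∈ J, HasDerivWithinAt f 0 J t) {s t : ℝ} (hs : s ∈ J) (ht : t ∈ J) : f t = f s := by
  have := Convex.norm_image_sub_le_of_norm_hasDerivWithin_le (C := 0) hf (by simp) hJ.convex hs ht
  rw [zero_mul, norm_le_zero_iff, sub_eq_zero] at this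
  exact this

/-- A solution of `w' = τ w` on an interval with continuous `τ` keeps its sign. -/
theorem pos_div_of_hasDerivWithinAt_mul {J : Set ℝ} (hJ : J.OrdConnected) {w τ : ℝ → ℝ}
    (hτ : ContinuousOn τ J) (hw : ∀ t ∈ J, HasDerivWithinAt w (τ t * w t) J t)
    {s t : ℝ} (hs : s ∈ J) (ht : t ∈ J) (h0 : w s ≠ 0) : 0 < w t / w s := by
  have hI : uIcc s t ⊆ J := hJ.uIcc_subset hs ht
  have hle : min s t ≤ max s t := min_le_max
  -- Extending `τ` by constants beyond the end points makes its primitive differentiable everywhere,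
  -- and `exp` of minus this primitive is an integrating factor.
  set σ : ℝ → ℝ := IccExtend hle ((Icc (min s t) (max s t)).domRestrict τ) with hσ
  have hσc : Continuous σ := (hτ.mono hI).domRestrict.Icc_extend'
  have hσe : ∀ x ∈ uIcc s t, σ x = τ x := fun x hx => by
    rw [hσ, IccExtend_of_mem hle _ hx]; rfl
  have hT : ∀ x, HasDerivAt (fun x => ∫ y in s..x, σ y) (σ x) x := fun x =>
    intervalIntegral.integral_hasDerivAt_right (hσc.intervalIntegrable _ _)
      hσc.stronglyMeasurable.stronglyMeasurableAtFilter hσc.continuousAt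
  have hc : ∀ x ∈ uIcc s t, HasDerivWithinAt
      (fun x => w x * Real.exp (-∫ y in s..x, σ y)) 0 (uIcc s t) x := fun x hx => by
    refine (((hw x (hI hx)).mono hI).mul ((hT x).neg.exp.hasDerivWithinAt)).congr_deriv ?_
    rw [hσe x hx]; ring
  have := eq_of_hasDerivWithinAt_zero ordConnected_uIcc hc left_mem_uIcc right_mem_uIcc
  simp only [intervalIntegral.integral_same, neg_zero, Real.exp_zero, mul_one] at this
  rw [← this] at h0 ⊢
  have hw0 : w t ≠ 0 := left_ne_zero_of_mul h0
  rw [div_mul_cancel_left₀ hw0]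
  positivity

section SpaceTime

variable {J : Set ℝ} {Ω : ℝ → Set Space}

theorem isOpen_of_spaceTime (hO : ∃ O : Set (ℝ × Space), IsOpen O ∧
    spaceTime J Ω = O ∩ (J ×ˢ univ)) {t : ℝ} (ht : t ∈ J) : IsOpen (Ω t) := by
  obtain ⟨O, hO, h⟩ := hO
  have : Ω t = (fun x : Space => (t, x)) ⁻¹' O := by
    ext x
    have := Set.ext_iff.1 h (t, x)
    simpa [spaceTime, ht] using this
  rw [this]
  exact hO.preimage (by fun_prop)

theorem eventually_mem_of_spaceTime (hO : ∃ O : Set (ℝ × Space), IsOpen O ∧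
    spaceTime J Ω = O ∩ (J ×ˢ univ)) {t : ℝ} (ht : t ∈ J) {x : Space} (hx : x ∈ Ω t) :
    ∀ᶠ s in 𝓝[J] t, x ∈ Ω s := by
  obtain ⟨O, hO, h⟩ := hO
  have hm : (t, x) ∈ O := (h.subset (show (t, x) ∈ spaceTime J Ω from ⟨ht, hx⟩)).1
  have hc : Continuous fun s : ℝ => (s, x) := by fun_prop
  have : ∀ᶠ s in 𝓝 t, (s, x) ∈ O := hc.continuousAt.eventually (hO.mem_nhds hm)
  filter_upwards [nhdsWithin_le_nhds this, self_mem_nhdsWithin] with s hs hsJ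
  exact (h.superset (show (s, x) ∈ O ∩ (J ×ˢ univ) from ⟨hs, hsJ, trivial⟩)).2

variable {F : Type*} [NormedAddCommGroup F] [NormedSpace ℝ F] {f : ℝ → Space → F}

theorem differentiableAt_space (hO : ∃ O : Set (ℝ × Space), IsOpen O ∧
    spaceTime J Ω = O ∩ (J ×ˢ univ))
    (hf : DifferentiableOn ℝ (fun q : ℝ × Space => f q.1 q.2) (spaceTime J Ω))
    {t : ℝ} (ht : t ∈ J) {x : Space} (hx : x ∈ Ω t) : DifferentiableAt ℝ (f t) x := by
  have h := hf (t, x) ⟨ht, hx⟩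
  have hc : DifferentiableWithinAt ℝ (fun y : Space => (t, y)) (Ω t) x := by fun_prop
  exact (h.comp x hc fun y hy => show (t, y) ∈ spaceTime J Ω from ⟨ht, hy⟩).differentiableAt
    ((isOpen_of_spaceTime hO ht).mem_nhds hx)

theorem differentiableWithinAt_time (hO : ∃ O : Set (ℝ × Space), IsOpen O ∧
    spaceTime J Ω = O ∩ (J ×ˢ univ))
    (hf : DifferentiableOn ℝ (fun q : ℝ × Space => f q.1 q.2) (spaceTime J Ω))
    {t : ℝ} (ht : t ∈ J) {x : Space} (hx : x ∈ Ω t) :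
    DifferentiableWithinAt ℝ (fun s => f s x) J t := by
  have h := hf (t, x) ⟨ht, hx⟩
  have hc : DifferentiableWithinAt ℝ (fun s : ℝ => (s, x)) (J ∩ {s | x ∈ Ω s}) t := by fun_prop
  refine (h.comp t hc fun s hs => show (s, x) ∈ spaceTime J Ω from ⟨hs.1, hs.2⟩).mono_of_mem_nhdsWithin ?_
  exact inter_mem self_mem_nhdsWithin (eventually_mem_of_spaceTime hO ht hx)

/-- The material derivative along a curve that stays inside the space-time region. -/
theorem hasDerivWithinAt_along_curve (hJu : UniqueDiffOn ℝ J)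
    (hO : ∃ O : Set (ℝ × Space), IsOpen O ∧ spaceTime J Ω = O ∩ (J ×ˢ univ))
    (hf : DifferentiableOn ℝ (fun q : ℝ × Space => f q.1 q.2) (spaceTime J Ω))
    {c : ℝ → Space} {v : Space} {t : ℝ} (ht : t ∈ J) (hc : HasDerivWithinAt c v J t)
    (hm : ∀ s ∈ J, c s ∈ Ω s) :
    HasDerivWithinAt (fun s => f s (c s))
      (derivWithin (fun s => f s (c t)) J t + fderiv ℝ (f t) (c t) v) J t := by
  have hx := hm t ht
  -- The time derivative, the space derivative and the derivative along the curve are all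
  -- restrictions of the single joint derivative `D`, and `D (1, 0) + D (0, v) = D (1, v)`.
  obtain ⟨D, hD⟩ := hf (t, c t) ⟨ht, hx⟩
  have h1 : HasDerivWithinAt (fun s => f s (c t)) (D (1, 0)) J t := by
    have hc : HasDerivWithinAt (fun s : ℝ => (s, c t)) ((1 : ℝ), (0 : Space))
        (J ∩ {s | c t ∈ Ω s}) t := (hasDerivWithinAt_id _ _).prodMk (hasDerivWithinAt_const _ _ _)
    refine (HasFDerivWithinAt.comp_hasDerivWithinAt (l := fun q : ℝ × Space => f q.1 q.2) t hD hc
      fun s hs => show (s, c t) ∈ spaceTime J Ω from ⟨hs.1, hs.2⟩).mono_of_mem_nhdsWithin ?_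
    exact inter_mem self_mem_nhdsWithin (eventually_mem_of_spaceTime hO ht hx)
  have h2 : HasFDerivAt (f t) (D ∘L ContinuousLinearMap.inr ℝ ℝ Space) (c t) := by
    have hc : HasFDerivWithinAt (fun y : Space => (t, y)) (ContinuousLinearMap.inr ℝ ℝ Space)
        (Ω t) (c t) := (hasFDerivAt_prodMk_right t (c t)).hasFDerivWithinAt
    exact (HasFDerivWithinAt.comp (g := fun q : ℝ × Space => f q.1 q.2) (c t) hD hc
      fun y hy => show (t, y) ∈ spaceTime J Ω from ⟨ht, hy⟩).hasFDerivAt ((isOpen_of_spaceTime hO ht).mem_nhds hx)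
  have h3 : HasDerivWithinAt (fun s => f s (c s)) (D (1, v)) J t :=
    HasFDerivWithinAt.comp_hasDerivWithinAt (l := fun q : ℝ × Space => f q.1 q.2) t hD
      ((hasDerivWithinAt_id _ _).prodMk hc) fun s hs =>
        show (s, c s) ∈ spaceTime J Ω from ⟨hs, hm s hs⟩
  refine h3.congr_deriv ?_
  rw [h1.derivWithin (hJu t ht), h2.fderiv]
  simp [← map_add]

end SpaceTime

/-- An open nonempty set of the plane contains two linearly independent vectors. -/
theorem exists_det_ne_zero_of_isOpen {S : Set Plane} (hS : IsOpen S) (hne : S.Nonempty) :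
    ∃ u ∈ S, ∃ v ∈ S, u 0 * v 1 - u 1 * v 0 ≠ 0 := by
  obtain ⟨y, hy⟩ := hne
  have h1 : ∀ᶠ s in 𝓝 (0 : ℝ), (![y 0 + s, y 1] : Plane) ∈ S := by
    have hc : Continuous fun s : ℝ => (![y 0 + s, y 1] : Plane) := by fun_prop
    refine hc.continuousAt.eventually (hS.mem_nhds ?_)
    convert hy
    ext i; fin_cases i <;> simp
  have h2 : ∀ᶠ s in 𝓝 (0 : ℝ), (![y 0, y 1 + s] : Plane) ∈ S := by
    have hc : Continuous fun s : ℝ => (![y 0, y 1 + s] : Plane) := by fun_prop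
    refine hc.continuousAt.eventually (hS.mem_nhds ?_)
    convert hy
    ext i; fin_cases i <;> simp
  -- The determinant of the two shifted vectors is `s * (s + y 0 + y 1)`, so only these two values
  -- of `s` must be avoided.
  have h3 : ∀ᶠ s in 𝓝[≠] (0 : ℝ), s ≠ -(y 0 + y 1) := by
    rcases eq_or_ne (-(y 0 + y 1)) 0 with h | h
    · rw [h]; exact self_mem_nhdsWithin
    · exact nhdsWithin_le_nhds (isOpen_ne.mem_nhds h.symm)
  obtain ⟨s, ⟨⟨hs1, hs2⟩, hs3⟩, hs4⟩ := ((((h1.and h2).filter_mono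
    nhdsWithin_le_nhds).and h3).and (self_mem_nhdsWithin (s := {(0 : ℝ)}ᶜ))).exists
  refine ⟨_, hs1, _, hs2, ?_⟩
  have h4 : s ≠ 0 := hs4
  have h5 : s + (y 0 + y 1) ≠ 0 := fun h => hs3 (by linarith)
  simp only [Matrix.cons_val_zero, Matrix.cons_val_one]
  convert mul_ne_zero h4 h5 using 1
  ring

end MaterialDerivative

/-! ### The flow of a horizontal section is linear. -/

section LinearFlow

@[simp] theorem lift_zero (y : Plane) (z : ℝ) : lift y z 0 = y 0 := rfl
@[simp] theorem lift_one (y : Plane) (z : ℝ) : lift y z 1 = y 1 := rfl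
@[simp] theorem lift_two (y : Plane) (z : ℝ) : lift y z 2 = z := rfl

theorem mulVec_fin_two_zero (A : Matrix (Fin 2) (Fin 2) ℝ) (y : Plane) :
    A.mulVec y 0 = A 0 0 * y 0 + A 0 1 * y 1 := by
  simp [Matrix.mulVec, dotProduct, Fin.sum_univ_two]

theorem mulVec_fin_two_one (A : Matrix (Fin 2) (Fin 2) ℝ) (y : Plane) :
    A.mulVec y 1 = A 1 0 * y 0 + A 1 1 * y 1 := by
  simp [Matrix.mulVec, dotProduct, Fin.sum_univ_two]

theorem isOpen_slice {W : Set Space} (hW : IsOpen W) (z : ℝ) : IsOpen (slice W z) := by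
  refine hW.preimage (f := fun y : Plane => lift y z) ?_
  unfold lift
  fun_prop

variable {J : Set ℝ} {Ω : ℝ → Set Space} {U : ℝ → Space → Space} {a b c d : ℝ → ℝ → ℝ}

/-- The regularity of the coefficients is inherited from `U`: two fixed independent points of the
section remain in it for nearby times, and Cramer's rule recovers the coefficients from the
velocities there. -/
theorem differentiableWithinAt_coeff
    (hO : ∃ O : Set (ℝ × Space), IsOpen O ∧ spaceTime J Ω = O ∩ (J ×ˢ univ))
    (hU : DifferentiableOn ℝ (fun q : ℝ × Space => U q.1 q.2) (spaceTime J Ω))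
    (hlin : HasLinearProfile J Ω U a b c d) {t z : ℝ} (ht : t ∈ J)
    (hne : (slice (Ω t) z).Nonempty) :
    DifferentiableWithinAt ℝ (fun s => a s z) J t ∧
    DifferentiableWithinAt ℝ (fun s => b s z) J t ∧
    DifferentiableWithinAt ℝ (fun s => c s z) J t ∧
    DifferentiableWithinAt ℝ (fun s => d s z) J t := by
  obtain ⟨u, hu, v, hv, huv⟩ :=
    exists_det_ne_zero_of_isOpen (isOpen_slice (isOpen_of_spaceTime hO ht) z) hne
  have hdu := differentiableWithinAt_pi.1 (differentiableWithinAt_time hO hU ht hu)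
  have hdv := differentiableWithinAt_pi.1 (differentiableWithinAt_time hO hU ht hv)
  have hev : ∀ᶠ s in 𝓝[J] t,
      U s (lift u z) = ![a s z * u 0 + b s z * u 1, c s z * u 0 + d s z * u 1, 0] ∧
      U s (lift v z) = ![a s z * v 0 + b s z * v 1, c s z * v 0 + d s z * v 1, 0] := by
    filter_upwards [self_mem_nhdsWithin, eventually_mem_of_spaceTime hO ht hu,
      eventually_mem_of_spaceTime hO ht hv] with s hs h1 h2
    exact ⟨hlin s hs _ h1, hlin s hs _ h2⟩
  have key : ∀ (f : ℝ → ℝ) (i : Fin 3) (k l : ℝ), (∀ᶠ s in 𝓝[J] t,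
      f s = (U s (lift u z) i * k + U s (lift v z) i * l) / (u 0 * v 1 - u 1 * v 0)) →
      DifferentiableWithinAt ℝ f J t := fun f i k l h => by
    refine DifferentiableWithinAt.congr_of_eventuallyEq ?_ h (h.self_of_nhdsWithin ht)
    exact (((hdu i).mul_const k).add ((hdv i).mul_const l)).div_const _
  refine ⟨key _ 0 (v 1) (-u 1) ?_, key _ 0 (-v 0) (u 0) ?_, key _ 1 (v 1) (-u 1) ?_,
    key _ 1 (-v 0) (u 0) ?_⟩ <;>
  · filter_upwards [hev] with s hs
    rw [hs.1, hs.2, eq_div_iff huv]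
    simp
    ring

/-- A line in a horizontal direction stays at one height, where `U` is linear; no regularity of the
coefficients in the height is needed. -/
theorem fderiv_velocity
    (hO : ∃ O : Set (ℝ × Space), IsOpen O ∧ spaceTime J Ω = O ∩ (J ×ˢ univ))
    (hU : DifferentiableOn ℝ (fun q : ℝ × Space => U q.1 q.2) (spaceTime J Ω))
    (hlin : HasLinearProfile J Ω U a b c d) {t : ℝ} (ht : t ∈ J) {x : Space} (hx : x ∈ Ω t)
    {v : Space} (hv : v 2 = 0) :
    fderiv ℝ (U t) x v =
      ![a t (x 2) * v 0 + b t (x 2) * v 1, c t (x 2) * v 0 + d t (x 2) * v 1, 0] := by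
  have hΩ := isOpen_of_spaceTime hO ht
  have h1 : HasDerivAt (fun s : ℝ => U t (x + s • v)) (fderiv ℝ (U t) x v) 0 :=
    (differentiableAt_space hO hU ht hx).hasFDerivAt.hasLineDerivAt v
  have h2 : ∀ᶠ s in 𝓝 (0 : ℝ), x + s • v ∈ Ω t := by
    have hc : Continuous fun s : ℝ => x + s • v := by fun_prop
    exact hc.continuousAt.eventually (hΩ.mem_nhds (by simpa using hx))
  have h3 : HasDerivAt (fun s : ℝ => (![a t (x 2) * (x 0 + s * v 0) + b t (x 2) * (x 1 + s * v 1),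
      c t (x 2) * (x 0 + s * v 0) + d t (x 2) * (x 1 + s * v 1), 0] : Space))
      ![a t (x 2) * v 0 + b t (x 2) * v 1, c t (x 2) * v 0 + d t (x 2) * v 1, 0] 0 := by
    have hl : ∀ i, HasDerivAt (fun s : ℝ => x i + s * v i) (v i) 0 := fun i =>
      (((hasDerivAt_id (0 : ℝ)).mul_const (v i)).const_add (x i)).congr_deriv (one_mul _)
    rw [hasDerivAt_pi]
    intro i
    fin_cases i
    · exact ((hl 0).const_mul _).add ((hl 1).const_mul _)
    · exact ((hl 0).const_mul _).add ((hl 1).const_mul _)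
    · exact hasDerivAt_const _ _
  refine (h1.congr_of_eventuallyEq ?_).unique h3
  filter_upwards [h2] with s hs
  rw [hlin t ht _ hs]
  simp [hv]

/-- The vertical term drops out because the third component of `U` is zero in a whole neighbourhood
of `x`. -/
theorem divg_velocity
    (hO : ∃ O : Set (ℝ × Space), IsOpen O ∧ spaceTime J Ω = O ∩ (J ×ˢ univ))
    (hU : DifferentiableOn ℝ (fun q : ℝ × Space => U q.1 q.2) (spaceTime J Ω))
    (hlin : HasLinearProfile J Ω U a b c d) {t : ℝ} (ht : t ∈ J) {x : Space} (hx : x ∈ Ω t) :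
    divg (U t) x = a t (x 2) + d t (x 2) := by
  have hd := (differentiableAt_space hO hU ht hx).hasFDerivAt
  have hi : ∀ i, fderiv ℝ (fun y => U t y i) x = _ := fun i => (hasFDerivAt_pi'.1 hd i).fderiv
  have h2 : fderiv ℝ (fun y => U t y 2) x = 0 := by
    refine HasFDerivAt.fderiv ((hasFDerivAt_const (0 : ℝ) x).congr_of_eventuallyEq ?_)
    filter_upwards [(isOpen_of_spaceTime hO ht).mem_nhds hx] with y hy
    rw [hlin t ht y hy]; simp
  rw [divg, Fin.sum_univ_three, h2, hi, hi]
  simp only [ContinuousLinearMap.comp_apply, ContinuousLinearMap.proj_apply]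
  rw [fderiv_velocity hO hU hlin ht hx (by simp), fderiv_velocity hO hU hlin ht hx (by simp)]
  simp

theorem divg_smul {n : ℕ} {f : (Fin n → ℝ) → ℝ} {V : (Fin n → ℝ) → (Fin n → ℝ)} {x : Fin n → ℝ}
    (hf : DifferentiableAt ℝ f x) (hV : DifferentiableAt ℝ V x) :
    divg (fun y => f y • V y) x = fderiv ℝ f x (V x) + f x * divg V x := by
  have h : ∀ i, fderiv ℝ (fun y => (f y • V y) i) x (Pi.single i 1) =
      V x i * fderiv ℝ f x (Pi.single i 1) + f x * fderiv ℝ (fun y => V y i) x (Pi.single i 1) := by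
    intro i
    have h1 := (hf.hasFDerivAt.mul (hasFDerivAt_pi'.1 hV.hasFDerivAt i)).fderiv
    have h2 := (hasFDerivAt_pi'.1 hV.hasFDerivAt i).fderiv
    simp only [Pi.smul_apply, smul_eq_mul]
    rw [show (fun y => f y * V y i) = (f * fun y => V y i) from rfl, h1, h2]
    simp
    ring
  rw [divg, Finset.sum_congr rfl fun i _ => h i, Finset.sum_add_distrib, divg, Finset.mul_sum]
  congr 1
  conv_rhs => rw [← Finset.univ_sum_single (V x), map_sum]
  refine Finset.sum_congr rfl fun i _ => ?_
  rw [← smul_eq_mul (V x i), ← map_smul, ← Pi.single_smul, smul_eq_mul, mul_one]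

/-- A flow of the section at height `z` by linear maps. -/
structure IsLinearFlow (J : Set ℝ) (Ω : ℝ → Set Space) (U : ℝ → Space → Space)
    (a b c d : ℝ → ℝ → ℝ) (z : ℝ) (M : ℝ → Matrix (Fin 2) (Fin 2) ℝ) : Prop where
  zero : M 0 = 1
  deriv : ∀ t ∈ J, ∀ i j, HasDerivWithinAt (fun s => M s i j)
    ((mat (a t z) (b t z) (c t z) (d t z) * M t) i j) J t
  det_pos : ∀ t ∈ J, 0 < (M t).det
  slice_eq : ∀ t ∈ J, slice (Ω t) z = (M t).mulVec '' slice (Ω 0) z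

theorem flow_height_eq (hJ : J.OrdConnected) (h0 : (0 : ℝ) ∈ J)
    (hlin : HasLinearProfile J Ω U a b c d) {φ : ℝ → Space → Space}
    (hφ0 : ∀ y ∈ Ω 0, φ 0 y = y)
    (hφ : ∀ y ∈ Ω 0, ∀ t ∈ J, HasDerivWithinAt (fun s => φ s y) (U t (φ t y)) J t)
    (hφΩ : ∀ t ∈ J, Ω t = φ t '' Ω 0) {y : Space} (hy : y ∈ Ω 0) {t : ℝ} (ht : t ∈ J) :
    φ t y 2 = y 2 := by
  have := eq_of_hasDerivWithinAt_zero hJ (f := fun s => φ s y 2) (fun s hs => by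
    refine (hasDerivWithinAt_pi.1 (hφ y hy s hs) 2).congr_deriv ?_
    rw [hlin s hs _ (by rw [hφΩ s hs]; exact mem_image_of_mem _ hy)]; simp) h0 ht
  rw [this, hφ0 y hy]

theorem slice_eq_empty (hJ : J.OrdConnected) (h0 : (0 : ℝ) ∈ J)
    (hΩ : IsMaterialVolume J U Ω) (hlin : HasLinearProfile J Ω U a b c d) {z : ℝ}
    (hz : slice (Ω 0) z = ∅) {t : ℝ} (ht : t ∈ J) : slice (Ω t) z = ∅ := by
  obtain ⟨φ, hφ0, hφ, hφΩ⟩ := hΩ.flow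
  refine eq_empty_of_forall_notMem fun y hy => ?_
  have hy' : lift y z ∈ φ t '' Ω 0 := by rw [← hφΩ t ht]; exact hy
  obtain ⟨w, hw, hwy⟩ := hy'
  have hw2 : w 2 = z := by
    rw [← flow_height_eq hJ h0 hlin hφ0 hφ hφΩ hw ht, hwy]; rfl
  refine Set.eq_empty_iff_forall_notMem.1 hz ![w 0, w 1] ?_
  have hwl : lift ![w 0, w 1] z = w := by
    ext i
    fin_cases i
    · rfl
    · rfl
    · exact hw2.symm
  rw [slice, mem_ofPred_eq, hwl]
  exact hw

/-- By Liouville's formula the determinant of any two trajectories satisfies `w' = (a + d) w`, so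
ratios of such determinants are constant in time. These ratios are the coordinates of a trajectory
in the basis of two fixed ones, so the given flow is itself linear on the section, and no existence
theorem for linear equations is required. -/
theorem exists_isLinearFlow (hJ : J.OrdConnected) (h0 : (0 : ℝ) ∈ J)
    (hΩ : IsMaterialVolume J U Ω)
    (hU : DifferentiableOn ℝ (fun q : ℝ × Space => U q.1 q.2) (spaceTime J Ω))
    (hlin : HasLinearProfile J Ω U a b c d) {z : ℝ} (hne : (slice (Ω 0) z).Nonempty) :
    ∃ M, IsLinearFlow J Ω U a b c d z M := by
  have hO := hΩ.isOpen
  obtain ⟨φ, hφ0, hφ, hφΩ⟩ := hΩ.flow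
  have hmem : ∀ y ∈ Ω 0, ∀ t ∈ J, φ t y ∈ Ω t := fun y hy t ht => by
    rw [hφΩ t ht]; exact mem_image_of_mem _ hy
  have hz : ∀ y ∈ Ω 0, ∀ t ∈ J, φ t y 2 = y 2 := fun y hy t ht =>
    flow_height_eq hJ h0 hlin hφ0 hφ hφΩ hy ht
  have hd0 : ∀ y ∈ slice (Ω 0) z, ∀ t ∈ J, HasDerivWithinAt (fun s => φ s (lift y z) 0)
      (a t z * φ t (lift y z) 0 + b t z * φ t (lift y z) 1) J t := fun y hy t ht => by
    refine (hasDerivWithinAt_pi.1 (hφ _ hy t ht) 0).congr_deriv ?_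
    rw [hlin t ht _ (hmem _ hy t ht), hz _ hy t ht]; simp
  have hd1 : ∀ y ∈ slice (Ω 0) z, ∀ t ∈ J, HasDerivWithinAt (fun s => φ s (lift y z) 1)
      (c t z * φ t (lift y z) 0 + d t z * φ t (lift y z) 1) J t := fun y hy t ht => by
    refine (hasDerivWithinAt_pi.1 (hφ _ hy t ht) 1).congr_deriv ?_
    rw [hlin t ht _ (hmem _ hy t ht), hz _ hy t ht]; simp
  have hW : ∀ y ∈ slice (Ω 0) z, ∀ y' ∈ slice (Ω 0) z, ∀ t ∈ J, HasDerivWithinAt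
      (fun s => φ s (lift y z) 0 * φ s (lift y' z) 1 - φ s (lift y z) 1 * φ s (lift y' z) 0)
      ((a t z + d t z) *
        (φ t (lift y z) 0 * φ t (lift y' z) 1 - φ t (lift y z) 1 * φ t (lift y' z) 0)) J t :=
    fun y hy y' hy' t ht => by
      refine (((hd0 y hy t ht).mul (hd1 y' hy' t ht)).sub
        ((hd1 y hy t ht).mul (hd0 y' hy' t ht))).congr_deriv ?_
      ring
  obtain ⟨u, hu, v, hv, huv⟩ :=
    exists_det_ne_zero_of_isOpen (isOpen_slice (isOpen_of_spaceTime hO h0) z) hne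
  have hnet : ∀ t ∈ J, (slice (Ω t) z).Nonempty := fun t ht => by
    refine ⟨![φ t (lift u z) 0, φ t (lift u z) 1], ?_⟩
    have h := hmem _ hu t ht
    have : lift ![φ t (lift u z) 0, φ t (lift u z) 1] z = φ t (lift u z) := by
      ext i
      fin_cases i
      · rfl
      · rfl
      · exact (hz _ hu t ht).symm
    rw [slice, mem_ofPred_eq, this]; exact h
  -- Continuity of the trace is what keeps the determinant of the trajectories of `u` and `v` away
  -- from zero.
  have hτ : ContinuousOn (fun t => a t z + d t z) J := fun t ht => by
    have := differentiableWithinAt_coeff hO hU hlin ht (hnet t ht)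
    exact this.1.continuousWithinAt.add this.2.2.2.continuousWithinAt
  set W : Plane → Plane → ℝ → ℝ := fun y y' s =>
    φ s (lift y z) 0 * φ s (lift y' z) 1 - φ s (lift y z) 1 * φ s (lift y' z) 0 with hWdef
  have hW0 : ∀ y ∈ slice (Ω 0) z, ∀ y' ∈ slice (Ω 0) z,
      W y y' 0 = y 0 * y' 1 - y 1 * y' 0 := fun y hy y' hy' => by
    rw [hWdef]; simp only [hφ0 _ hy, hφ0 _ hy', lift_zero, lift_one]
  have hpos : ∀ t ∈ J, 0 < W u v t / (u 0 * v 1 - u 1 * v 0) := fun t ht => by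
    rw [← hW0 u hu v hv] at huv ⊢
    exact pos_div_of_hasDerivWithinAt_mul hJ hτ (hW u hu v hv) h0 ht huv
  have hWne : ∀ t ∈ J, W u v t ≠ 0 := fun t ht h => by
    have := hpos t ht
    rw [h, zero_div] at this
    exact lt_irrefl _ this
  have hratio : ∀ y ∈ slice (Ω 0) z, ∀ y' ∈ slice (Ω 0) z, ∀ t ∈ J,
      W y y' t * (u 0 * v 1 - u 1 * v 0) = (y 0 * y' 1 - y 1 * y' 0) * W u v t :=
    fun y hy y' hy' t ht => by
      have := eq_of_hasDerivWithinAt_zero hJ (f := fun s => W y y' s / W u v s) (fun s hs => by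
        refine ((hW y hy y' hy' s hs).div (hW u hu v hv s hs) (hWne s hs)).congr_deriv ?_
        rw [div_eq_zero_iff]; left; ring) h0 ht
      simp only [hW0 u hu v hv, hW0 y hy y' hy'] at this
      rwa [div_eq_div_iff (hWne t ht) huv] at this
  set D := u 0 * v 1 - u 1 * v 0 with hD
  -- The matrix that sends `u` and `v` to their positions at time `s`.
  set M : ℝ → Matrix (Fin 2) (Fin 2) ℝ := fun s =>
    mat ((φ s (lift u z) 0 * v 1 - φ s (lift v z) 0 * u 1) / D)
      ((φ s (lift v z) 0 * u 0 - φ s (lift u z) 0 * v 0) / D)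
      ((φ s (lift u z) 1 * v 1 - φ s (lift v z) 1 * u 1) / D)
      ((φ s (lift v z) 1 * u 0 - φ s (lift u z) 1 * v 0) / D) with hM
  have hMφ : ∀ y ∈ slice (Ω 0) z, ∀ t ∈ J, lift ((M t).mulVec y) z = φ t (lift y z) := by
    intro y hy t ht
    have h1 := hratio y hy v hv t ht
    have h2 := hratio u hu y hy t ht
    have hw := hWne t ht
    ext i
    fin_cases i
    · simp only [Fin.zero_eta, lift_zero, mulVec_fin_two_zero, hM, mat, Matrix.of_apply,
        Matrix.cons_val', Matrix.cons_val_zero, Matrix.cons_val_one, Matrix.cons_val_fin_one]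
      field_simp
      apply mul_left_cancel₀ hw
      simp only [hWdef] at h1 h2 ⊢
      -- The identity `W(u,v) y = W(y,v) u + W(u,y) v` for vectors of the plane, applied to the
      -- positions at time `t`.
      linear_combination (-φ t (lift u z) 0) * h1 - φ t (lift v z) 0 * h2
    · simp only [Fin.mk_one, lift_one, mulVec_fin_two_one, hM, mat, Matrix.of_apply,
        Matrix.cons_val', Matrix.cons_val_zero, Matrix.cons_val_one, Matrix.cons_val_fin_one]
      field_simp
      apply mul_left_cancel₀ hw
      simp only [hWdef] at h1 h2 ⊢
      linear_combination (-φ t (lift u z) 1) * h1 - φ t (lift v z) 1 * h2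
    · exact (hz _ hy t ht).symm
  refine ⟨M, ?_, ?_, ?_, ?_⟩
  · simp only [hM, hφ0 _ hu, hφ0 _ hv, lift_zero, lift_one]
    ext i j
    fin_cases i <;> fin_cases j <;>
      simp only [mat, Matrix.of_apply, Matrix.cons_val', Matrix.cons_val_zero, Matrix.cons_val_one,
        Matrix.cons_val_fin_one, Fin.zero_eta, Fin.mk_one, Fin.isValue, Matrix.one_apply_eq,
        ne_eq, one_ne_zero, zero_ne_one, not_false_eq_true, Matrix.one_apply_ne]
    · rw [div_eq_one_iff_eq huv, hD]; ring
    · rw [div_eq_zero_iff]; left; ring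
    · rw [div_eq_zero_iff]; left; ring
    · rw [div_eq_one_iff_eq huv, hD]; ring
  · intro t ht i j
    have x0 := hd0 u hu t ht
    have x1 := hd1 u hu t ht
    have y0 := hd0 v hv t ht
    have y1 := hd1 v hv t ht
    fin_cases i <;> fin_cases j <;>
      simp only [hM, mat, Matrix.mul_apply, Fin.sum_univ_two, Matrix.of_apply,
        Matrix.cons_val', Matrix.cons_val_zero, Matrix.cons_val_one, Matrix.cons_val_fin_one,
        Fin.zero_eta, Fin.mk_one, Fin.isValue]
    · exact (((x0.mul_const _).sub (y0.mul_const _)).div_const D).congr_deriv (by ring)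
    · exact (((y0.mul_const _).sub (x0.mul_const _)).div_const D).congr_deriv (by ring)
    · exact (((x1.mul_const _).sub (y1.mul_const _)).div_const D).congr_deriv (by ring)
    · exact (((y1.mul_const _).sub (x1.mul_const _)).div_const D).congr_deriv (by ring)
  · intro t ht
    convert hpos t ht using 1
    simp only [hM, mat, Matrix.det_fin_two, Matrix.of_apply, Matrix.cons_val', Matrix.cons_val_zero,
      Matrix.cons_val_one, Matrix.cons_val_fin_one, hWdef]
    field_simp
    rw [hD]
    ring
  · intro t ht
    ext y
    constructor
    · intro hy
      have hy' : lift y z ∈ φ t '' Ω 0 := by rw [← hφΩ t ht]; exact hy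
      obtain ⟨w, hw, hwy⟩ := hy'
      have hw2 : w 2 = z := by rw [← hz w hw t ht, hwy]; rfl
      have hwl : lift ![w 0, w 1] z = w := by
        ext i
        fin_cases i
        · rfl
        · rfl
        · exact hw2.symm
      have hws : (![w 0, w 1] : Plane) ∈ slice (Ω 0) z := by
        rw [slice, mem_ofPred_eq, hwl]; exact hw
      refine ⟨_, hws, ?_⟩
      have h := hMφ _ hws t ht
      rw [hwl, hwy] at h
      ext i
      fin_cases i
      · exact congrFun h 0
      · exact congrFun h 1
    · rintro ⟨w, hw, rfl⟩
      rw [slice, mem_ofPred_eq, hMφ w hw t ht]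
      exact hmem _ hw t ht

end LinearFlow

/-! ### Conservation along the flow and the moment equations. -/

section Transport

variable {J : Set ℝ} {Ω : ℝ → Set Space} {U : ℝ → Space → Space} {a b c d : ℝ → ℝ → ℝ}
  {ρ p : ℝ → Space → ℝ} {γ l g z : ℝ} {μ : ℝ → ℝ} {M : ℝ → Matrix (Fin 2) (Fin 2) ℝ}

theorem IsLinearFlow.hasDerivWithinAt_entries (hM : IsLinearFlow J Ω U a b c d z M) {t : ℝ}
    (ht : t ∈ J) :
    HasDerivWithinAt (fun s => M s 0 0) (a t z * M t 0 0 + b t z * M t 1 0) J t ∧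
    HasDerivWithinAt (fun s => M s 0 1) (a t z * M t 0 1 + b t z * M t 1 1) J t ∧
    HasDerivWithinAt (fun s => M s 1 0) (c t z * M t 0 0 + d t z * M t 1 0) J t ∧
    HasDerivWithinAt (fun s => M s 1 1) (c t z * M t 0 1 + d t z * M t 1 1) J t := by
  have h := hM.deriv t ht
  simp only [mat, Matrix.mul_apply, Fin.sum_univ_two, Matrix.of_apply,
    Matrix.cons_val', Matrix.cons_val_fin_one] at h
  exact ⟨h 0 0, h 0 1, h 1 0, h 1 1⟩

theorem IsLinearFlow.mem (hM : IsLinearFlow J Ω U a b c d z M) {t : ℝ} (ht : t ∈ J) {y : Plane}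
    (hy : y ∈ slice (Ω 0) z) : lift ((M t).mulVec y) z ∈ Ω t :=
  (hM.slice_eq t ht).superset (mem_image_of_mem _ hy)

theorem IsLinearFlow.hasDerivWithinAt_trajectory (hM : IsLinearFlow J Ω U a b c d z M)
    (hlin : HasLinearProfile J Ω U a b c d) {t : ℝ} (ht : t ∈ J) {y : Plane}
    (hy : y ∈ slice (Ω 0) z) :
    HasDerivWithinAt (fun s => lift ((M s).mulVec y) z) (U t (lift ((M t).mulVec y) z)) J t := by
  obtain ⟨h00, h01, h10, h11⟩ := hM.hasDerivWithinAt_entries ht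
  rw [hlin t ht _ (hM.mem ht hy), hasDerivWithinAt_pi]
  intro i
  fin_cases i
  · simp only [Fin.zero_eta, lift_zero, lift_one, lift_two, mulVec_fin_two_zero,
      mulVec_fin_two_one, Matrix.cons_val_zero]
    exact ((h00.mul_const _).add (h01.mul_const _)).congr_deriv (by ring)
  · simp only [Fin.mk_one, lift_zero, lift_one, lift_two, mulVec_fin_two_zero,
      mulVec_fin_two_one, Matrix.cons_val_one, Matrix.cons_val_zero]
    exact ((h10.mul_const _).add (h11.mul_const _)).congr_deriv (by ring)
  · exact hasDerivWithinAt_const _ _ _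

theorem IsLinearFlow.hasDerivWithinAt_det (hM : IsLinearFlow J Ω U a b c d z M) {t : ℝ}
    (ht : t ∈ J) :
    HasDerivWithinAt (fun s => (M s).det) ((a t z + d t z) * (M t).det) J t := by
  obtain ⟨h00, h01, h10, h11⟩ := hM.hasDerivWithinAt_entries ht
  simp only [Matrix.det_fin_two]
  exact ((h00.mul h11).sub (h01.mul h10)).congr_deriv (by ring)

/-- Along a trajectory the logarithmic rates of `ρ` and `det M` are `-(a + d)` and `a + d`. -/
theorem density_transport (hJ : J.OrdConnected) (hJ' : J.Nontrivial) (h0 : (0 : ℝ) ∈ J)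
    (hΩ : IsMaterialVolume J U Ω) (hsol : IsClassicalSolution γ l g μ J Ω ρ p U)
    (hlin : HasLinearProfile J Ω U a b c d) (hM : IsLinearFlow J Ω U a b c d z M)
    {t : ℝ} (ht : t ∈ J) {y : Plane} (hy : y ∈ slice (Ω 0) z) :
    (M t).det * ρ t (lift ((M t).mulVec y) z) = ρ 0 (lift y z) := by
  have hρ := hsol.density_contDiffOn.differentiableOn one_ne_zero
  have hU := hsol.velocity_contDiffOn.differentiableOn one_ne_zero
  have hO := hΩ.isOpen
  have := eq_of_hasDerivWithinAt_zero hJ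
    (f := fun s => (M s).det * ρ s (lift ((M s).mulVec y) z)) (fun s hs => by
      refine ((hM.hasDerivWithinAt_det hs).mul (hasDerivWithinAt_along_curve
        (uniqueDiffOn_of_ordConnected_of_nontrivial hJ hJ') hO hρ hs
        (hM.hasDerivWithinAt_trajectory hlin hs hy) fun r hr => hM.mem hr hy)).congr_deriv ?_
      have hm := hM.mem hs hy
      have h := hsol.mass s hs _ hm
      rw [divg_smul (differentiableAt_space hO hρ hs hm) (differentiableAt_space hO hU hs hm),
        divg_velocity hO hU hlin hs hm, lift_two] at h
      linear_combination (M s).det * h) h0 ht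
  simpa [hM.zero] using this

theorem pressure_transport (hJ : J.OrdConnected) (hJ' : J.Nontrivial) (h0 : (0 : ℝ) ∈ J)
    (hΩ : IsMaterialVolume J U Ω) (hsol : IsClassicalSolution γ l g μ J Ω ρ p U)
    (hlin : HasLinearProfile J Ω U a b c d) (hM : IsLinearFlow J Ω U a b c d z M)
    {t : ℝ} (ht : t ∈ J) {y : Plane} (hy : y ∈ slice (Ω 0) z) :
    (M t).det ^ γ * p t (lift ((M t).mulVec y) z) = p 0 (lift y z) := by
  have hp := hsol.pressure_contDiffOn.differentiableOn one_ne_zero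
  have hU := hsol.velocity_contDiffOn.differentiableOn one_ne_zero
  have hO := hΩ.isOpen
  have := eq_of_hasDerivWithinAt_zero hJ
    (f := fun s => (M s).det ^ γ * p s (lift ((M s).mulVec y) z)) (fun s hs => by
      have hpos := hM.det_pos s hs
      refine (((hM.hasDerivWithinAt_det hs).rpow_const (.inl hpos.ne')).mul
        (hasDerivWithinAt_along_curve
        (uniqueDiffOn_of_ordConnected_of_nontrivial hJ hJ') hO hp hs
        (hM.hasDerivWithinAt_trajectory hlin hs hy) fun r hr => hM.mem hr hy)).congr_deriv ?_
      have hm := hM.mem hs hy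
      have h := hsol.pressure s hs _ hm
      rw [divg_velocity hO hU hlin hs hm, lift_two] at h
      rw [Real.rpow_sub_one hpos.ne']
      field_simp
      linear_combination (M s).det ^ γ * h) h0 ht
  simpa [hM.zero] using this

theorem setIntegral_image_mulVec {A : Matrix (Fin 2) (Fin 2) ℝ} (hA : 0 < A.det) {S : Set Plane}
    (hS : MeasurableSet S) (f : Plane → ℝ) :
    (∫ y in A.mulVec '' S, f y) = ∫ y in S, A.det * f (A.mulVec y) := by
  have h := integral_image_eq_integral_abs_det_fderiv_smul volume hS
    (fun x _ => (hasFDerivAt_mulVec A x).hasFDerivWithinAt)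
    (Matrix.mulVec_injective_of_isUnit ((Matrix.isUnit_iff_isUnit_det A).2 hA.ne'.isUnit)).injOn f
  rw [h]
  have hdet : (LinearMap.toContinuousLinearMap A.mulVecLin).det = A.det := by
    rw [LinearMap.det_toContinuousLinearMap, ← Matrix.toLin'_apply', LinearMap.det_toLin']
  simp only [hdet, abs_of_pos hA, smul_eq_mul]

theorem integrableOn_image_mulVec_iff {A : Matrix (Fin 2) (Fin 2) ℝ} (hA : 0 < A.det)
    {S : Set Plane} (hS : MeasurableSet S) (f : Plane → ℝ) :
    IntegrableOn f (A.mulVec '' S) ↔ IntegrableOn (fun y => A.det * f (A.mulVec y)) S := by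
  have h := integrableOn_image_iff_integrableOn_abs_det_fderiv_smul volume hS
    (fun x _ => (hasFDerivAt_mulVec A x).hasFDerivWithinAt)
    (Matrix.mulVec_injective_of_isUnit ((Matrix.isUnit_iff_isUnit_det A).2 hA.ne'.isUnit)).injOn f
  have hdet : (LinearMap.toContinuousLinearMap A.mulVecLin).det = A.det := by
    rw [LinearMap.det_toContinuousLinearMap, ← Matrix.toLin'_apply', LinearMap.det_toLin']
  simpa only [hdet, abs_of_pos hA, smul_eq_mul] using h

theorem continuous_lift (z : ℝ) : Continuous fun y : Plane => lift y z := by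
  unfold lift
  fun_prop

theorem continuousOn_slice {f : Space → ℝ} {W : Set Space}
    (hf : ContinuousOn f W) (z : ℝ) : ContinuousOn (fun y => f (lift y z)) (slice W z) :=
  hf.comp (continuous_lift z).continuousOn fun _ hy => hy

/-- Quadratic moments of a nonnegative continuous function with finite second moments exist. -/
theorem integrableOn_mul_quadratic {S : Set Plane} (hS : MeasurableSet S) {r : Plane → ℝ}
    (hr : ContinuousOn r S) (hr0 : ∀ y ∈ S, 0 ≤ r y)
    (hi : IntegrableOn (fun y => r y * (y 0 ^ 2 + y 1 ^ 2)) S) (A B C : ℝ) :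
    IntegrableOn (fun y => r y * (A * y 0 ^ 2 + B * (y 0 * y 1) + C * y 1 ^ 2)) S := by
  refine (hi.const_mul (|A| + |B| + |C|)).mono' ?_ ?_
  · refine ContinuousOn.aestronglyMeasurable (hr.mul (Continuous.continuousOn ?_)) hS
    fun_prop
  · rw [ae_restrict_iff' hS]
    refine .of_forall fun y hy => ?_
    rw [norm_mul, Real.norm_of_nonneg (hr0 y hy)]
    rw [mul_left_comm (|A| + |B| + |C|)]
    refine mul_le_mul_of_nonneg_left ?_ (hr0 y hy)
    have h1 : |y 0 * y 1| ≤ y 0 ^ 2 + y 1 ^ 2 := by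
      rw [abs_le]; constructor <;> nlinarith [sq_nonneg (y 0 + y 1), sq_nonneg (y 0 - y 1)]
    calc ‖A * y 0 ^ 2 + B * (y 0 * y 1) + C * y 1 ^ 2‖
        ≤ |A * y 0 ^ 2| + |B * (y 0 * y 1)| + |C * y 1 ^ 2| := abs_add_three _ _ _
      _ = |A| * y 0 ^ 2 + |B| * |y 0 * y 1| + |C| * y 1 ^ 2 := by
        simp only [abs_mul, abs_pow, sq_abs]
      _ ≤ |A| * (y 0 ^ 2 + y 1 ^ 2) + |B| * (y 0 ^ 2 + y 1 ^ 2) + |C| * (y 0 ^ 2 + y 1 ^ 2) := by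
        gcongr
        · exact le_add_of_nonneg_right (sq_nonneg _)
        · exact le_add_of_nonneg_left (sq_nonneg _)
      _ = _ := by ring

theorem setIntegral_mul_quadratic {S : Set Plane} (hS : MeasurableSet S) {r : Plane → ℝ}
    (hr : ContinuousOn r S) (hr0 : ∀ y ∈ S, 0 ≤ r y)
    (hi : IntegrableOn (fun y => r y * (y 0 ^ 2 + y 1 ^ 2)) S) (A B C : ℝ) :
    (∫ y in S, r y * (A * y 0 ^ 2 + B * (y 0 * y 1) + C * y 1 ^ 2)) =
      A * (∫ y in S, r y * y 0 ^ 2) + B * (∫ y in S, r y * (y 0 * y 1)) +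
        C * ∫ y in S, r y * y 1 ^ 2 := by
  have h := integrableOn_mul_quadratic hS hr hr0 hi
  have h1 : IntegrableOn (fun y => r y * y 0 ^ 2) S := by simpa using h 1 0 0
  have h2 : IntegrableOn (fun y => r y * (y 0 * y 1)) S := by simpa using h 0 1 0
  have h3 : IntegrableOn (fun y => r y * y 1 ^ 2) S := by simpa using h 0 0 1
  have h12 : IntegrableOn (fun y => A * (r y * y 0 ^ 2) + B * (r y * (y 0 * y 1))) S :=
    (h1.const_mul A).add (h2.const_mul B)
  rw [← integral_const_mul, ← integral_const_mul, ← integral_const_mul,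
    ← integral_add (h1.const_mul A) (h2.const_mul B),
    ← integral_add h12 (h3.const_mul C)]
  congr 1
  ext y
  ring

theorem density_continuousOn (hΩ : IsMaterialVolume J U Ω)
    (hsol : IsClassicalSolution γ l g μ J Ω ρ p U) {t : ℝ} (ht : t ∈ J) :
    ContinuousOn (fun y => ρ t (lift y z)) (slice (Ω t) z) :=
  continuousOn_slice (fun _ hx => (differentiableAt_space hΩ.isOpen
    (hsol.density_contDiffOn.differentiableOn one_ne_zero) ht
    hx).continuousAt.continuousWithinAt) z

/-- The functionals at time `t` in terms of those at time `0` and the flow matrix. -/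
theorem functionals_transport (hJ : J.OrdConnected) (hJ' : J.Nontrivial) (h0 : (0 : ℝ) ∈ J)
    (hΩ : IsMaterialVolume J U Ω) (hsol : IsClassicalSolution γ l g μ J Ω ρ p U)
    (hlin : HasLinearProfile J Ω U a b c d) (hM : IsLinearFlow J Ω U a b c d z M)
    (hfin : FiniteMoments Ω ρ p 0 z) {t : ℝ} (ht : t ∈ J) :
    FiniteMoments Ω ρ p t z ∧
    Gx1 Ω ρ t z = M t 0 0 ^ 2 * Gx1 Ω ρ 0 z + 2 * M t 0 0 * M t 0 1 * Gx1x2 Ω ρ 0 z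
      + M t 0 1 ^ 2 * Gx2 Ω ρ 0 z ∧
    Gx2 Ω ρ t z = M t 1 0 ^ 2 * Gx1 Ω ρ 0 z + 2 * M t 1 0 * M t 1 1 * Gx1x2 Ω ρ 0 z
      + M t 1 1 ^ 2 * Gx2 Ω ρ 0 z ∧
    Gx1x2 Ω ρ t z = M t 0 0 * M t 1 0 * Gx1 Ω ρ 0 z
      + (M t 0 0 * M t 1 1 + M t 0 1 * M t 1 0) * Gx1x2 Ω ρ 0 z
      + M t 0 1 * M t 1 1 * Gx2 Ω ρ 0 z ∧
    Ep Ω p γ t z = (M t).det ^ (1 - γ) * Ep Ω p γ 0 z := by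
  have hpos := hM.det_pos t ht
  have hS := (isOpen_slice (isOpen_of_spaceTime hΩ.isOpen h0) z).measurableSet
  have hρc := density_continuousOn (z := z) hΩ hsol h0
  have hρ0 : ∀ y ∈ slice (Ω 0) z, 0 ≤ ρ 0 (lift y z) := fun y hy => hsol.density_nonneg 0 h0 _ hy
  have hρt : ∀ (q : Plane → ℝ), ∀ y ∈ slice (Ω 0) z,
      (M t).det * (ρ t (lift ((M t).mulVec y) z) * q ((M t).mulVec y)) =
        ρ 0 (lift y z) * q ((M t).mulVec y) := fun q y hy => by
    rw [← mul_assoc, density_transport hJ hJ' h0 hΩ hsol hlin hM ht hy]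
  -- The Jacobian of the change of variables supplies one power of the determinant against the `γ`
  -- powers carried by `p`.
  have hpt : ∀ y ∈ slice (Ω 0) z, (M t).det * p t (lift ((M t).mulVec y) z) =
      (M t).det ^ (1 - γ) * p 0 (lift y z) := fun y hy => by
    rw [← pressure_transport hJ hJ' h0 hΩ hsol hlin hM ht hy, ← mul_assoc, ← Real.rpow_add hpos,
      sub_add_cancel, Real.rpow_one]
  -- The density absorbs the Jacobian, so a quadratic moment at time `t` is the moment at time `0`
  -- of the pulled-back quadratic form.
  have hint : ∀ q : Plane → ℝ, ∀ A B C : ℝ,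
      (∀ y, q ((M t).mulVec y) = A * y 0 ^ 2 + B * (y 0 * y 1) + C * y 1 ^ 2) →
      (∫ y in slice (Ω t) z, ρ t (lift y z) * q y) =
        A * (∫ y in slice (Ω 0) z, ρ 0 (lift y z) * y 0 ^ 2)
        + B * (∫ y in slice (Ω 0) z, ρ 0 (lift y z) * (y 0 * y 1))
        + C * ∫ y in slice (Ω 0) z, ρ 0 (lift y z) * y 1 ^ 2 := fun q A B C hq => by
    rw [hM.slice_eq t ht, setIntegral_image_mulVec hpos hS, setIntegral_congr_fun hS (hρt q)]
    simp only [hq]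
    exact setIntegral_mul_quadratic hS hρc hρ0 hfin.1 A B C
  refine ⟨⟨?_, ?_⟩, ?_, ?_, ?_, ?_⟩
  · rw [hM.slice_eq t ht, integrableOn_image_mulVec_iff hpos hS,
      integrableOn_congr_fun (hρt fun y => y 0 ^ 2 + y 1 ^ 2) hS]
    refine (integrableOn_mul_quadratic hS hρc hρ0 hfin.1 (M t 0 0 ^ 2 + M t 1 0 ^ 2)
      (2 * M t 0 0 * M t 0 1 + 2 * M t 1 0 * M t 1 1)
      (M t 0 1 ^ 2 + M t 1 1 ^ 2)).congr_fun (fun y _ => ?_) hS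
    simp only [mulVec_fin_two_zero, mulVec_fin_two_one]
    ring
  · rw [hM.slice_eq t ht, integrableOn_image_mulVec_iff hpos hS, integrableOn_congr_fun hpt hS]
    exact hfin.2.const_mul _
  · rw [Gx1, hint (fun y => y 0 ^ 2) (M t 0 0 ^ 2) (2 * M t 0 0 * M t 0 1) (M t 0 1 ^ 2)
      (fun y => by rw [mulVec_fin_two_zero]; ring), Gx1, Gx2, Gx1x2]
    ring
  · rw [Gx2, hint (fun y => y 1 ^ 2) (M t 1 0 ^ 2) (2 * M t 1 0 * M t 1 1) (M t 1 1 ^ 2)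
      (fun y => by rw [mulVec_fin_two_one]; ring), Gx1, Gx2, Gx1x2]
    ring
  · rw [Gx1x2, hint (fun y => y 0 * y 1) (M t 0 0 * M t 1 0)
      (M t 0 0 * M t 1 1 + M t 0 1 * M t 1 0) (M t 0 1 * M t 1 1)
      (fun y => by simp only [mulVec_fin_two_zero, mulVec_fin_two_one]; ring), Gx1, Gx2, Gx1x2]
    ring
  · rw [Ep, hM.slice_eq t ht, setIntegral_image_mulVec hpos hS, setIntegral_congr_fun hS hpt,
      integral_const_mul, Ep]
    ring

theorem moments_hasDerivWithinAt (hJ : J.OrdConnected) (hJ' : J.Nontrivial) (h0 : (0 : ℝ) ∈ J)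
    (hΩ : IsMaterialVolume J U Ω) (hsol : IsClassicalSolution γ l g μ J Ω ρ p U)
    (hlin : HasLinearProfile J Ω U a b c d) (hfin : FiniteMoments Ω ρ p 0 z)
    {t : ℝ} (ht : t ∈ J) :
    FiniteMoments Ω ρ p t z ∧
      HasDerivWithinAt (fun s => Gx1 Ω ρ s z)
        (2 * a t z * Gx1 Ω ρ t z + 2 * b t z * Gx1x2 Ω ρ t z) J t ∧
      HasDerivWithinAt (fun s => Gx2 Ω ρ s z)
        (2 * d t z * Gx2 Ω ρ t z + 2 * c t z * Gx1x2 Ω ρ t z) J t ∧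
      HasDerivWithinAt (fun s => Gx1x2 Ω ρ s z)
        ((a t z + d t z) * Gx1x2 Ω ρ t z + b t z * Gx2 Ω ρ t z + c t z * Gx1 Ω ρ t z) J t ∧
      HasDerivWithinAt (fun s => Ep Ω p γ s z)
        (-(γ - 1) * (a t z + d t z) * Ep Ω p γ t z) J t ∧
      HasDerivWithinAt (fun s => Delta Ω ρ s z)
        (2 * (a t z + d t z) * Delta Ω ρ t z) J t := by
  suffices h : FiniteMoments Ω ρ p t z ∧
      HasDerivWithinAt (fun s => Gx1 Ω ρ s z)
        (2 * a t z * Gx1 Ω ρ t z + 2 * b t z * Gx1x2 Ω ρ t z) J t ∧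
      HasDerivWithinAt (fun s => Gx2 Ω ρ s z)
        (2 * d t z * Gx2 Ω ρ t z + 2 * c t z * Gx1x2 Ω ρ t z) J t ∧
      HasDerivWithinAt (fun s => Gx1x2 Ω ρ s z)
        ((a t z + d t z) * Gx1x2 Ω ρ t z + b t z * Gx2 Ω ρ t z + c t z * Gx1 Ω ρ t z) J t ∧
      HasDerivWithinAt (fun s => Ep Ω p γ s z)
        (-(γ - 1) * (a t z + d t z) * Ep Ω p γ t z) J t by
    obtain ⟨hf, h1, h2, h3, h4⟩ := h
    refine ⟨hf, h1, h2, h3, h4, ((h1.mul h2).sub (h3.pow 2)).congr_deriv ?_⟩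
    simp only [Delta]
    ring
  rcases (slice (Ω 0) z).eq_empty_or_nonempty with he | hne
  -- An empty section carries no independent trajectories from which to build `M`, but then all
  -- functionals vanish identically.
  · have he' : ∀ s ∈ J, slice (Ω s) z = ∅ := fun s hs => slice_eq_empty hJ h0 hΩ hlin he hs
    have hG1 : ∀ s ∈ J, Gx1 Ω ρ s z = 0 := fun s hs => by simp [Gx1, he' s hs]
    have hG2 : ∀ s ∈ J, Gx2 Ω ρ s z = 0 := fun s hs => by simp [Gx2, he' s hs]
    have hG3 : ∀ s ∈ J, Gx1x2 Ω ρ s z = 0 := fun s hs => by simp [Gx1x2, he' s hs]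
    have hE : ∀ s ∈ J, Ep Ω p γ s z = 0 := fun s hs => by simp [Ep, he' s hs]
    have key : ∀ f : ℝ → ℝ, (∀ s ∈ J, f s = 0) → HasDerivWithinAt f 0 J t := fun f hf =>
      (hasDerivWithinAt_const t J (0 : ℝ)).congr hf (hf t ht)
    rw [hG1 t ht, hG2 t ht, hG3 t ht, hE t ht]
    refine ⟨⟨?_, ?_⟩, ?_, ?_, ?_, ?_⟩
    · rw [he' t ht]; exact integrableOn_empty
    · rw [he' t ht]; exact integrableOn_empty
    · simpa using key _ hG1
    · simpa using key _ hG2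
    · simpa using key _ hG3
    · simpa using key _ hE
  · obtain ⟨M, hM⟩ := exists_isLinearFlow hJ h0 hΩ
      (hsol.velocity_contDiffOn.differentiableOn one_ne_zero) hlin hne
    have hT := fun s (hs : s ∈ J) =>
      functionals_transport hJ hJ' h0 hΩ hsol hlin hM hfin hs
    obtain ⟨hf, e1, e2, e3, e4⟩ := hT t ht
    obtain ⟨h00, h01, h10, h11⟩ := hM.hasDerivWithinAt_entries ht
    refine ⟨hf, ?_, ?_, ?_, ?_⟩
    · refine HasDerivWithinAt.congr ?_ (fun s hs => (hT s hs).2.1) e1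
      rw [e1, e3]
      refine ((((h00.pow 2).mul_const _).add (((h00.const_mul 2).mul h01).mul_const _)).add
        ((h01.pow 2).mul_const _)).congr_deriv ?_
      ring
    · refine HasDerivWithinAt.congr ?_ (fun s hs => (hT s hs).2.2.1) e2
      rw [e2, e3]
      refine ((((h10.pow 2).mul_const _).add (((h10.const_mul 2).mul h11).mul_const _)).add
        ((h11.pow 2).mul_const _)).congr_deriv ?_
      ring
    · refine HasDerivWithinAt.congr ?_ (fun s hs => (hT s hs).2.2.2.1) e3
      rw [e1, e2, e3]
      refine ((((h00.mul h10).mul_const _).add (((h00.mul h11).add (h01.mul h10)).mul_const _)).add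
        ((h01.mul h11).mul_const _)).congr_deriv ?_
      ring
    · refine HasDerivWithinAt.congr ?_ (fun s hs => (hT s hs).2.2.2.2) e4
      rw [e4]
      have hpos := hM.det_pos t ht
      refine (((hM.hasDerivWithinAt_det ht).rpow_const (.inl hpos.ne')).mul_const _).congr_deriv ?_
      rw [Real.rpow_sub_one hpos.ne']
      field_simp
      ring

end Transport

/-! ### Integration by parts over an arbitrary open set. -/

section IntegrationByParts

/-- Smooth cutoffs exhausting the space, with gradients of size `O(1 / ‖x‖)`. -/
theorem exists_cutoff_seq (E : Type*) [NormedAddCommGroup E] [NormedSpace ℝ E]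
    [FiniteDimensional ℝ E] :
    ∃ (χ : ℕ → E → ℝ) (C : ℝ), (∀ n, ContDiff ℝ 1 (χ n)) ∧ (∀ n, HasCompactSupport (χ n)) ∧
      (∀ n x, |χ n x| ≤ 1) ∧ (∀ n x, ‖fderiv ℝ (χ n) x‖ * ‖x‖ ≤ C) ∧
      ∀ x, ∀ᶠ n in atTop, χ n x = 1 ∧ fderiv ℝ (χ n) x = 0 := by
  let β : ContDiffBump (0 : E) := default
  have hβ : ContDiff ℝ 1 (β : E → ℝ) := β.contDiff
  have hβ1 : ∀ᶠ x in 𝓝 (0 : E), β x = 1 := β.eventuallyEq_one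
  obtain ⟨C, hC⟩ := ((hβ.continuous_fderiv one_ne_zero).norm.mul
    continuous_norm).bounded_above_of_compact_support
    ((β.hasCompactSupport.fderiv (𝕜 := ℝ)).norm.mul_right)
  have hN : ∀ n : ℕ, ((n : ℝ) + 1)⁻¹ ≠ 0 := fun n => by positivity
  have hf : ∀ (n : ℕ) x, fderiv ℝ (fun x => β (((n : ℝ) + 1)⁻¹ • x)) x =
      ((n : ℝ) + 1)⁻¹ • fderiv ℝ β (((n : ℝ) + 1)⁻¹ • x) := fun n x => by
    rw [fderiv_comp_smul]
  refine ⟨fun n x => β (((n : ℝ) + 1)⁻¹ • x), C, fun n => hβ.comp (by fun_prop),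
    fun n => β.hasCompactSupport.comp_smul (hN n), fun n x => ?_, fun n x => ?_, fun x => ?_⟩
  · rw [abs_of_nonneg β.nonneg]; exact β.le_one
  -- The product of `‖x‖` and the norm of the derivative is invariant under dilation, so the bound
  -- for one bump serves every `n`.
  · rw [hf, norm_smul]
    refine le_trans (le_of_eq ?_) ((le_abs_self _).trans (hC (((n : ℝ) + 1)⁻¹ • x)))
    rw [Pi.mul_apply, norm_smul]
    ring
  · have ht : Tendsto (fun n : ℕ => ((n : ℝ) + 1)⁻¹ • x) atTop (𝓝 0) := by
      have := (tendsto_one_div_add_atTop_nhds_zero_nat (𝕜 := ℝ)).smul_const x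
      simpa using this
    filter_upwards [ht.eventually hβ1.eventually_nhds] with n hn
    refine ⟨hn.self_of_nhds, ?_⟩
    rw [hf, (EventuallyEq.fderiv_eq (f := fun _ => (1 : ℝ)) hn)]
    simp

/-- Differentiable functions vanishing near `0` that approximate the identity. -/
theorem exists_truncation_seq :
    ∃ (ψ ψ' : ℕ → ℝ → ℝ) (C : ℝ), (∀ n u, HasDerivAt (ψ n) (ψ' n u) u) ∧
      (∀ n, ∀ᶠ u in 𝓝 0, ψ n u = 0) ∧ (∀ n u, |ψ n u| ≤ |u|) ∧ (∀ n u, |ψ' n u| ≤ C) ∧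
      ∀ u ≠ 0, ∀ᶠ n in atTop, ψ n u = u ∧ ψ' n u = 1 := by
  let β : ContDiffBump (0 : ℝ) := default
  have hβ : ContDiff ℝ 1 (β : ℝ → ℝ) := β.contDiff
  have hβ1 : ∀ᶠ x in 𝓝 (0 : ℝ), β x = 1 := β.eventuallyEq_one
  have hdc : Continuous (deriv (β : ℝ → ℝ)) := hβ.continuous_deriv le_rfl
  obtain ⟨C, hC⟩ := (continuous_id.mul hdc).bounded_above_of_compact_support
    (β.hasCompactSupport.deriv.mul_left)
  -- The last term of the derivative is `x * β' x` at `x = (n + 1) * u`, hence bounded uniformly in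
  -- `n`.
  have hd : ∀ (n : ℕ) (u : ℝ), HasDerivAt (fun u => u * (1 - β (((n : ℝ) + 1) * u)))
      ((1 - β (((n : ℝ) + 1) * u)) - ((n : ℝ) + 1) * u * deriv β (((n : ℝ) + 1) * u)) u :=
    fun n u => by
      have h1 : HasDerivAt (fun u => β (((n : ℝ) + 1) * u))
          (deriv β (((n : ℝ) + 1) * u) * ((n : ℝ) + 1)) u :=
        ((hβ.differentiable one_ne_zero).differentiableAt.hasDerivAt).comp u
          (((hasDerivAt_id u).const_mul ((n : ℝ) + 1)).congr_deriv (mul_one _))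
      refine ((hasDerivAt_id u).mul (h1.const_sub 1)).congr_deriv ?_
      simp only [id]
      ring
  refine ⟨_, _, 1 + C, hd, fun n => ?_, fun n u => ?_, fun n u => ?_, fun u hu => ?_⟩
  · have ht : Tendsto (fun u : ℝ => ((n : ℝ) + 1) * u) (𝓝 0) (𝓝 0) := by
      have : Continuous fun u : ℝ => ((n : ℝ) + 1) * u := by fun_prop
      simpa using this.tendsto 0
    filter_upwards [ht.eventually hβ1] with u hu
    rw [hu]; ring
  · rw [abs_mul]
    refine mul_le_of_le_one_right (abs_nonneg _) ?_
    rw [abs_le]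
    constructor <;> linarith [β.nonneg (x := ((n : ℝ) + 1) * u), β.le_one (x := ((n : ℝ) + 1) * u)]
  · refine (abs_sub _ _).trans (add_le_add ?_ (hC _))
    rw [abs_le]
    constructor <;> linarith [β.nonneg (x := ((n : ℝ) + 1) * u), β.le_one (x := ((n : ℝ) + 1) * u)]
  · have ht : Tendsto (fun n : ℕ => ((n : ℝ) + 1) * u) atTop (cocompact ℝ) := by
      rw [← Metric.cobounded_eq_cocompact, ← tendsto_norm_atTop_iff_cobounded]
      simp only [norm_mul]
      refine Tendsto.atTop_mul_const (norm_pos_iff.2 hu) ?_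
      exact tendsto_norm_atTop_atTop.comp
        (tendsto_atTop_add_const_right _ _ tendsto_natCast_atTop_atTop)
    have hz : ∀ᶠ x in cocompact ℝ, x ∉ tsupport β :=
      β.hasCompactSupport.isCompact.compl_mem_cocompact
    filter_upwards [ht.eventually hz] with n hn
    have h1 := image_eq_zero_of_notMem_tsupport hn
    have h2 : deriv β (((n : ℝ) + 1) * u) = 0 := by
      by_contra h
      exact hn (support_deriv_subset h)
    rw [h1, h2]
    constructor <;> ring

variable {X : Type*} [TopologicalSpace X]

theorem continuous_indicator_of_tendsto_zero {S : Set X} (hS : IsOpen S) {f : X → ℝ}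
    (hf : ContinuousOn f S) (hb : ∀ y ∈ frontier S, Tendsto f (𝓝[S] y) (𝓝 0)) :
    Continuous (S.indicator f) := by
  rw [continuous_iff_continuousAt]
  intro x
  by_cases hx : x ∈ S
  · refine (hf.continuousAt (hS.mem_nhds hx)).congr ?_
    filter_upwards [hS.mem_nhds hx] with y hy
    rw [indicator_of_mem hy]
  · rw [ContinuousAt, indicator_of_notMem hx]
    have h1 : Tendsto (S.indicator f) (𝓝[S] x) (𝓝 0) := by
      by_cases hc : x ∈ closure S
      · refine (hb x ⟨hc, fun h => hx (interior_subset h)⟩).congr' ?_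
        filter_upwards [self_mem_nhdsWithin] with y hy
        rw [indicator_of_mem hy]
      · rw [notMem_closure_iff_nhdsWithin_eq_bot.1 hc]
        exact tendsto_bot
    have h2 : Tendsto (S.indicator f) (𝓝[Sᶜ] x) (𝓝 0) := by
      refine tendsto_const_nhds.congr' ?_
      filter_upwards [self_mem_nhdsWithin] with y hy
      rw [indicator_of_notMem hy]
    rw [← nhdsWithin_univ, ← union_compl_self S, nhdsWithin_union]
    exact h1.sup h2

/-- Integration by parts against a coordinate over an arbitrary open set, for a nonnegative
integrable function that tends to zero at the boundary. -/
theorem setIntegral_coord_mul_fderiv {m : ℕ} {S : Set (Fin m → ℝ)} (hS : IsOpen S)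
    {f : (Fin m → ℝ) → ℝ} (hf0 : ∀ y ∈ S, 0 ≤ f y) (hd : ∀ y ∈ S, DifferentiableAt ℝ f y)
    (hb : ∀ y ∈ frontier S, Tendsto f (𝓝[S] y) (𝓝 0)) (hi : IntegrableOn f S) (i j : Fin m)
    (hij : IntegrableOn (fun y => y j * fderiv ℝ f y (Pi.single i 1)) S) :
    (∫ y in S, y j * fderiv ℝ f y (Pi.single i 1)) =
      -((Pi.single i 1 : Fin m → ℝ) j * ∫ y in S, f y) := by
  set e : Fin m → ℝ := Pi.single i 1 with he
  have he1 : ‖e‖ = 1 := by rw [he, Pi.norm_single, norm_one]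
  have hej : |e j| ≤ 1 := by rw [← he1]; exact norm_le_pi_norm e j
  obtain ⟨χ, C, hχ, hχs, hχ1, hχC, hχe⟩ := exists_cutoff_seq (Fin m → ℝ)
  obtain ⟨ψ, ψ', K, hψ, hψ0, hψ1, hψK, hψe⟩ := exists_truncation_seq
  have hK : 0 ≤ K := (abs_nonneg _).trans (hψK 0 0)
  have hψz : ∀ n, ψ n 0 = 0 := fun n => (hψ0 n).self_of_nhds
  set q := S.indicator f with hq
  have hqS : ∀ x ∈ S, q x = f x := fun x hx => indicator_of_mem hx f
  have hqc : Continuous q := continuous_indicator_of_tendsto_zero hS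
    (fun y hy => (hd y hy).continuousAt.continuousWithinAt) hb
  have hqi : Integrable q := hi.integrable_indicator hS.measurableSet
  have hqn : ∀ x ∉ S, q x = 0 := fun x hx => indicator_of_notMem hx f
  have hFS : ∀ n, ∀ x ∈ S, HasFDerivAt (fun x => ψ n (q x)) (ψ' n (f x) • fderiv ℝ f x) x :=
    fun n x hx => by
      refine (HasDerivAt.comp_hasFDerivAt x (hψ n (f x))
        (hd x hx).hasFDerivAt).congr_of_eventuallyEq ?_
      filter_upwards [hS.mem_nhds hx] with y hy
      rw [hqS y hy]; rfl
  -- Here the boundary is handled: `q` is continuous and zero at `x`, so `ψ n ∘ q` vanishes near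
  -- `x`. The truncated function is thus differentiable everywhere, whatever the shape of `S`.
  have hFn : ∀ n, ∀ x ∉ S, HasFDerivAt (fun x => ψ n (q x)) (0 : (Fin m → ℝ) →L[ℝ] ℝ) x :=
    fun n x hx => by
      refine (hasFDerivAt_const (0 : ℝ) x).congr_of_eventuallyEq ?_
      have : Tendsto q (𝓝 x) (𝓝 0) := by
        have := hqc.tendsto x; rwa [hqn x hx] at this
      exact this.eventually (hψ0 n)
  have hFd : ∀ n x, DifferentiableAt ℝ (fun x => ψ n (q x)) x := fun n x => by
    by_cases hx : x ∈ S
    · exact (hFS n x hx).differentiableAt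
    · exact (hFn n x hx).differentiableAt
  have hgd : ∀ n, Differentiable ℝ (fun x : Fin m → ℝ => x j * ψ n (q x)) := fun n x =>
    (hasFDerivAt_coord j x).differentiableAt.mul (hFd n x)
  have hgf : ∀ n x, fderiv ℝ (fun x : Fin m → ℝ => x j * ψ n (q x)) x e =
      e j * ψ n (q x) + x j * fderiv ℝ (fun x => ψ n (q x)) x e := fun n x => by
    have := ((hasFDerivAt_coord j x).mul (hFd n x).hasFDerivAt).fderiv
    rw [show (fun x : Fin m → ℝ => x j * ψ n (q x)) =
      (fun x : Fin m → ℝ => x j) * fun x => ψ n (q x) from rfl, this]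
    simp
    ring
  -- An integrable majorant independent of `n`, from `|ψ n u| ≤ |u|` and `|ψ' n u| ≤ K`.
  set B : (Fin m → ℝ) → ℝ := fun x => |q x| + K * S.indicator (fun y => |y j * fderiv ℝ f y e|) x
    with hB
  have hBi : Integrable B :=
    hqi.abs.add ((IntegrableOn.integrable_indicator (Integrable.abs hij) hS.measurableSet).const_mul K)
  have hgB : ∀ n x, |fderiv ℝ (fun x : Fin m → ℝ => x j * ψ n (q x)) x e| ≤ B x := fun n x => by
    rw [hgf]
    refine (abs_add_le _ _).trans (add_le_add ?_ ?_)
    · rw [abs_mul]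
      exact (mul_le_of_le_one_left (abs_nonneg _) hej).trans (hψ1 n _)
    · by_cases hx : x ∈ S
      · rw [(hFS n x hx).fderiv, indicator_of_mem hx, smul_apply, smul_eq_mul, mul_left_comm,
          abs_mul]
        exact mul_le_mul_of_nonneg_right (hψK n _) (abs_nonneg _)
      · rw [(hFn n x hx).fderiv, indicator_of_notMem hx]
        simp
  have hgm : ∀ n, Measurable fun x => fderiv ℝ (fun x : Fin m → ℝ => x j * ψ n (q x)) x e :=
    fun n => measurable_fderiv_apply_const ℝ _ e
  have hm1 : ∀ n, AEStronglyMeasurable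
      (fun x => χ n x * fderiv ℝ (fun x : Fin m → ℝ => x j * ψ n (q x)) x e) volume := fun n =>
    ((hχ n).continuous.measurable.mul (hgm n)).aestronglyMeasurable
  have hb1 : ∀ n x, ‖χ n x * fderiv ℝ (fun x : Fin m → ℝ => x j * ψ n (q x)) x e‖ ≤ B x :=
    fun n x => by
      rw [Real.norm_eq_abs, abs_mul]
      exact (mul_le_of_le_one_left (abs_nonneg _) (hχ1 n x)).trans (hgB n x)
  have hm2 : ∀ n, AEStronglyMeasurable
      (fun x => fderiv ℝ (χ n) x e * (x j * ψ n (q x))) volume := fun n => by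
    refine (Continuous.mul ?_ (hgd n).continuous).aestronglyMeasurable
    exact ((hχ n).continuous_fderiv one_ne_zero).clm_apply continuous_const
  -- The decay of the cutoff gradient compensates the factor `x j`, so integrability of `f` alone is
  -- enough, not of `x j * f`.
  have hb2 : ∀ n x, ‖fderiv ℝ (χ n) x e * (x j * ψ n (q x))‖ ≤ C * |q x| := fun n x => by
    rw [norm_mul, norm_mul, ← mul_assoc]
    refine mul_le_mul (le_trans ?_ (hχC n x)) (hψ1 n _) (abs_nonneg _)
      ((by positivity : (0 : ℝ) ≤ _).trans (hχC n x))
    refine mul_le_mul ?_ (norm_le_pi_norm x j) (norm_nonneg _) (norm_nonneg _)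
    simpa [he1] using (fderiv ℝ (χ n) x).le_opNorm e
  have hparts : ∀ n, (∫ x, χ n x * fderiv ℝ (fun x : Fin m → ℝ => x j * ψ n (q x)) x e) =
      -∫ x, fderiv ℝ (χ n) x e * (x j * ψ n (q x)) := fun n => by
    refine integral_mul_fderiv_eq_neg_fderiv_mul_of_integrable
      ((hqi.abs.const_mul C).mono' (hm2 n) (.of_forall (hb2 n)))
      (hBi.mono' (hm1 n) (.of_forall (hb1 n))) ?_
      (fun x _ => (hχ n).differentiable one_ne_zero x) (fun x _ => hgd n x)
    exact ((hχ n).continuous.mul (hgd n).continuous).integrable_of_hasCompactSupport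
      (hχs n).mul_right
  have hl2 : Tendsto (fun n => ∫ x, fderiv ℝ (χ n) x e * (x j * ψ n (q x))) atTop (𝓝 0) := by
    have := tendsto_integral_of_dominated_convergence (f := fun _ => (0 : ℝ)) _ hm2
      (hqi.abs.const_mul C) (fun n => .of_forall (hb2 n)) (.of_forall fun x => ?_)
    · simpa using this
    · refine tendsto_const_nhds.congr' ?_
      filter_upwards [hχe x] with n hn
      rw [hn.2]; simp
  have hl1 : Tendsto (fun n => ∫ x, χ n x * fderiv ℝ (fun x : Fin m → ℝ => x j * ψ n (q x)) x e)
      atTop (𝓝 (∫ x, S.indicator (fun y => e j * f y + y j * fderiv ℝ f y e) x)) := by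
    refine tendsto_integral_of_dominated_convergence _ hm1 hBi (fun n => .of_forall (hb1 n))
      (.of_forall fun x => tendsto_const_nhds.congr' ?_)
    filter_upwards [hχe x, eventually_imp_distrib_left.2 (hψe (q x))] with n hn hn'
    rw [hn.1, one_mul, hgf]
    by_cases hx : x ∈ S
    · rw [indicator_of_mem hx, (hFS n x hx).fderiv]
      rw [hqS x hx] at hn' ⊢
      -- At a zero of `f` the derivatives `ψ' n` need not tend to `1`; but `f ≥ 0` has a minimum
      -- there, so its gradient vanishes.
      by_cases h0 : f x = 0
      · have hmin : IsLocalMin f x := by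
          filter_upwards [hS.mem_nhds hx] with y hy
          rw [h0]; exact hf0 y hy
        rw [hmin.fderiv_eq_zero, h0, hψz]
        simp
      · rw [(hn' h0).1, (hn' h0).2, one_smul]
    · rw [indicator_of_notMem hx, (hFn n x hx).fderiv, hqn x hx, hψz]
      simp
  have hlim := tendsto_nhds_unique hl1 ((hl2.neg).congr fun n => (hparts n).symm)
  rw [integral_indicator hS.measurableSet, integral_add (hi.const_mul _) hij, integral_const_mul,
    neg_zero] at hlim
  linarith

end IntegrationByParts

/-! ### Positivity of `Δ`, the adiabatic relation and the closed system. -/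

section ClosedSystem

variable {J : Set ℝ} {Ω : ℝ → Set Space} {U : ℝ → Space → Space} {a b c d : ℝ → ℝ → ℝ}
  {ρ p : ℝ → Space → ℝ} {γ l g z : ℝ} {μ : ℝ → ℝ} {M : ℝ → Matrix (Fin 2) (Fin 2) ℝ}

/-- The expression is the integral of `r * (s * y 0 + k * y 1) ^ 2`. A nonzero linear form cannot
vanish on the whole nonempty open set `r ≠ 0`, so the integrand is positive on a nonempty open set.
-/
theorem setIntegral_mul_sq_linear_pos {S : Set Plane} (hS : IsOpen S) {r : Plane → ℝ}
    (hr : ContinuousOn r S) (hr0 : ∀ y ∈ S, 0 ≤ r y)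
    (hi : IntegrableOn (fun y => r y * (y 0 ^ 2 + y 1 ^ 2)) S)
    (hne : ∃ y ∈ S, r y ≠ 0) {s k : ℝ} (hsk : s ≠ 0 ∨ k ≠ 0) :
    0 < s ^ 2 * (∫ y in S, r y * y 0 ^ 2) + 2 * s * k * (∫ y in S, r y * (y 0 * y 1)) +
        k ^ 2 * ∫ y in S, r y * y 1 ^ 2 := by
  rw [← setIntegral_mul_quadratic hS.measurableSet hr hr0 hi]
  have hsq : ∀ y : Plane, s ^ 2 * y 0 ^ 2 + 2 * s * k * (y 0 * y 1) + k ^ 2 * y 1 ^ 2 =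
      (s * y 0 + k * y 1) ^ 2 := fun y => by ring
  have hint := integrableOn_mul_quadratic hS.measurableSet hr hr0 hi (s ^ 2) (2 * s * k) (k ^ 2)
  simp only [hsq] at hint ⊢
  have hnn : 0 ≤ᵐ[volume.restrict S] fun y => r y * (s * y 0 + k * y 1) ^ 2 := by
    rw [EventuallyLE, ae_restrict_iff' hS.measurableSet]
    exact .of_forall fun y hy => mul_nonneg (hr0 y hy) (sq_nonneg _)
  rw [setIntegral_pos_iff_support_of_nonneg_ae hnn hint]
  have hT : IsOpen (S ∩ r ⁻¹' {0}ᶜ) := hr.isOpen_inter_preimage hS isOpen_compl_singleton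
  obtain ⟨y₀, hy₀, hry₀⟩ := hne
  obtain ⟨u, hu, v, hv, huv⟩ := exists_det_ne_zero_of_isOpen hT ⟨y₀, hy₀, hry₀⟩
  have hw : ∃ w ∈ S ∩ r ⁻¹' {0}ᶜ, s * w 0 + k * w 1 ≠ 0 := by
    by_contra! h
    have h1 := h u hu
    have h2 := h v hv
    have hs : s * (u 0 * v 1 - u 1 * v 0) = 0 := by linear_combination v 1 * h1 - u 1 * h2
    have hk : k * (u 0 * v 1 - u 1 * v 0) = 0 := by linear_combination u 0 * h2 - v 0 * h1
    rw [mul_eq_zero, or_iff_left huv] at hs hk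
    exact hsk.elim (fun h => h hs) fun h => h hk
  obtain ⟨w, hwT, hw⟩ := hw
  have hL : IsOpen {y : Plane | s * y 0 + k * y 1 ≠ 0} :=
    isOpen_ne_fun (by fun_prop) continuous_const
  refine ((hT.inter hL).measure_pos volume ⟨w, hwT, hw⟩).trans_le (measure_mono ?_)
  rintro y ⟨⟨hyS, hyr⟩, hyl⟩
  exact ⟨mul_ne_zero hyr (pow_ne_zero 2 hyl), hyS⟩

theorem Delta_pos {t : ℝ} (ht : t ∈ J) (hΩ : IsMaterialVolume J U Ω)
    (hsol : IsClassicalSolution γ l g μ J Ω ρ p U) (hfin : FiniteMoments Ω ρ p t z)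
    (hne : ∃ y ∈ slice (Ω t) z, ρ t (lift y z) ≠ 0) : 0 < Delta Ω ρ t z := by
  have hS := isOpen_slice (isOpen_of_spaceTime hΩ.isOpen ht) z
  have key : ∀ s k : ℝ, (s ≠ 0 ∨ k ≠ 0) →
      0 < s ^ 2 * Gx1 Ω ρ t z + 2 * s * k * Gx1x2 Ω ρ t z + k ^ 2 * Gx2 Ω ρ t z := fun s k h => by
    have := setIntegral_mul_sq_linear_pos hS (density_continuousOn (z := z) hΩ hsol ht)
      (fun y hy => hsol.density_nonneg t ht _ hy) hfin.1 hne h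
    rw [Gx1, Gx2, Gx1x2]
    linarith
  have h1 : 0 < Gx1 Ω ρ t z := by simpa using key 1 0 (.inl one_ne_zero)
  -- At this vector the quadratic form of the moments equals `Gx1 * Δ`.
  have h2 := key (-Gx1x2 Ω ρ t z) (Gx1 Ω ρ t z) (.inr h1.ne')
  refine pos_of_mul_pos_right (a := Gx1 Ω ρ t z) ?_ h1.le
  rw [Delta]
  linarith

/-- `Δ` is the determinant of the matrix of moments, which transforms by congruence with `M t` and
so gains `(det M) ^ 2`, while `E_p` gains `(det M) ^ (1 - γ)`. -/
theorem Delta_pos_and_Ep_eq (hJ : J.OrdConnected) (hJ' : J.Nontrivial) (h0 : (0 : ℝ) ∈ J)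
    (hΩ : IsMaterialVolume J U Ω) (hsol : IsClassicalSolution γ l g μ J Ω ρ p U)
    (hlin : HasLinearProfile J Ω U a b c d) (hfin : FiniteMoments Ω ρ p 0 z)
    (hne : ∃ y ∈ slice (Ω 0) z, ρ 0 (lift y z) ≠ 0) {t : ℝ} (ht : t ∈ J) :
    0 < Delta Ω ρ t z ∧ Ep Ω p γ t z =
      Ep Ω p γ 0 z * Delta Ω ρ 0 z ^ ((γ - 1) / 2) * Delta Ω ρ t z ^ ((-γ + 1) / 2) := by
  have hΔ := Delta_pos h0 hΩ hsol hfin hne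
  obtain ⟨M, hM⟩ := exists_isLinearFlow hJ h0 hΩ
    (hsol.velocity_contDiffOn.differentiableOn one_ne_zero) hlin ⟨_, hne.choose_spec.1⟩
  obtain ⟨-, e1, e2, e3, e4⟩ := functionals_transport hJ hJ' h0 hΩ hsol hlin hM hfin ht
  have hpos := hM.det_pos t ht
  have hD : Delta Ω ρ t z = (M t).det ^ 2 * Delta Ω ρ 0 z := by
    rw [Delta, e1, e2, e3, Delta, Matrix.det_fin_two]
    ring
  refine ⟨by rw [hD]; positivity, ?_⟩
  rw [e4, hD, Real.mul_rpow (by positivity) hΔ.le, mul_assoc,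
    mul_left_comm (Delta Ω ρ 0 z ^ ((γ - 1) / 2)), ← Real.rpow_add hΔ,
    show (γ - 1) / 2 + (-γ + 1) / 2 = 0 by ring, Real.rpow_zero, mul_one, ← Real.rpow_natCast,
    ← Real.rpow_mul hpos.le, mul_comm]
  congr 2
  push_cast
  ring

theorem hasFDerivAt_lift (z : ℝ) (y : Plane) :
    HasFDerivAt (fun y : Plane => lift y z) (ContinuousLinearMap.pi
      ![ContinuousLinearMap.proj (R := ℝ) (φ := fun _ : Fin 2 => ℝ) 0,
        ContinuousLinearMap.proj (R := ℝ) (φ := fun _ : Fin 2 => ℝ) 1, 0]) y := by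
  rw [hasFDerivAt_pi]
  intro i
  fin_cases i
  · exact hasFDerivAt_coord 0 y
  · exact hasFDerivAt_coord 1 y
  · exact hasFDerivAt_const z y

theorem fderiv_comp_lift {f : Space → ℝ} {y : Plane} (hf : DifferentiableAt ℝ f (lift y z)) :
    fderiv ℝ (fun y => f (lift y z)) y (Pi.single 0 1) = grad f (lift y z) 0 ∧
    fderiv ℝ (fun y => f (lift y z)) y (Pi.single 1 1) = grad f (lift y z) 1 := by
  have h := (hf.hasFDerivAt.comp y (hasFDerivAt_lift z y)).fderiv
  rw [show (f ∘ fun y => lift y z) = fun y => f (lift y z) from rfl] at h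
  rw [h]
  constructor <;>
  · simp only [ContinuousLinearMap.comp_apply, grad]
    congr 1
    ext i
    fin_cases i <;> simp

/-- The horizontal momentum equations over a section, with `a', b', c', d'` the time derivatives
of the coefficients. -/
theorem horizontal_momentum (hJu : UniqueDiffOn ℝ J) (hΩ : IsMaterialVolume J U Ω)
    (hsol : IsClassicalSolution γ l g μ J Ω ρ p U)
    (hlin : HasLinearProfile J Ω U a b c d) {t a' b' c' d' : ℝ} (ht : t ∈ J)
    (ha : HasDerivWithinAt (fun s => a s z) a' J t) (hb : HasDerivWithinAt (fun s => b s z) b' J t)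
    (hc : HasDerivWithinAt (fun s => c s z) c' J t) (hd : HasDerivWithinAt (fun s => d s z) d' J t)
    {y : Plane} (hy : y ∈ slice (Ω t) z) :
    grad (p t) (lift y z) 0 = -(ρ t (lift y z) *
      ((a' + a t z ^ 2 + b t z * c t z - l * c t z + μ z * a t z) * y 0 +
        (b' + b t z * (a t z + d t z) - l * d t z + μ z * b t z) * y 1)) ∧
    grad (p t) (lift y z) 1 = -(ρ t (lift y z) *
      ((c' + c t z * (a t z + d t z) + l * a t z + μ z * c t z) * y 0 +
        (d' + d t z ^ 2 + b t z * c t z + l * b t z + μ z * d t z) * y 1)) := by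
  have hO := hΩ.isOpen
  have hU := hsol.velocity_contDiffOn.differentiableOn one_ne_zero
  have hx : lift y z ∈ Ω t := hy
  have hdt : HasDerivWithinAt (fun s => U s (lift y z))
      ![a' * y 0 + b' * y 1, c' * y 0 + d' * y 1, 0] J t := by
    have h : HasDerivWithinAt (fun s => (![a s z * y 0 + b s z * y 1,
        c s z * y 0 + d s z * y 1, 0] : Space))
        ![a' * y 0 + b' * y 1, c' * y 0 + d' * y 1, 0] J t := by
      rw [hasDerivWithinAt_pi]
      intro i
      fin_cases i
      · exact (ha.mul_const _).add (hb.mul_const _)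
      · exact (hc.mul_const _).add (hd.mul_const _)
      · exact hasDerivWithinAt_const _ _ _
    refine h.congr_of_eventuallyEq ?_ (hlin t ht _ hx)
    filter_upwards [self_mem_nhdsWithin, eventually_mem_of_spaceTime hO ht hx] with s hs h1
    exact hlin s hs _ h1
  have hm := hsol.momentum t ht _ hx
  have hU2 : U t (lift y z) 2 = 0 := by rw [hlin t ht _ hx]; simp
  rw [hdt.derivWithin (hJu t ht), fderiv_velocity hO hU hlin ht hx hU2, hlin t ht _ hx] at hm
  have hm0 := congrFun hm 0
  have hm1 := congrFun hm 1
  simp only [e3, horizontal, cross_apply, Pi.smul_apply, Pi.add_apply, Pi.neg_apply, smul_eq_mul,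
    Matrix.cons_val_zero, Matrix.cons_val_one, Matrix.cons_val, lift_zero, lift_one,
    lift_two] at hm0 hm1
  constructor
  · linear_combination hm0
  · linear_combination hm1

/-- The moments of the horizontal momentum equations. -/
theorem momentum_moments {S : Set Plane} (hS : IsOpen S) {f r : Plane → ℝ}
    (hf0 : ∀ y ∈ S, 0 ≤ f y) (hd : ∀ y ∈ S, DifferentiableAt ℝ f y)
    (hb : ∀ y ∈ frontier S, Tendsto f (𝓝[S] y) (𝓝 0)) (hfi : IntegrableOn f S)
    (hr : ContinuousOn r S) (hr0 : ∀ y ∈ S, 0 ≤ r y)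
    (hri : IntegrableOn (fun y => r y * (y 0 ^ 2 + y 1 ^ 2)) S) {i : Fin 2} {β₀ β₁ : ℝ}
    (h : ∀ y ∈ S, fderiv ℝ f y (Pi.single i 1) = -(r y * (β₀ * y 0 + β₁ * y 1))) :
    β₀ * (∫ y in S, r y * y 0 ^ 2) + β₁ * (∫ y in S, r y * (y 0 * y 1)) =
      (Pi.single i 1 : Plane) 0 * ∫ y in S, f y ∧
    β₀ * (∫ y in S, r y * (y 0 * y 1)) + β₁ * (∫ y in S, r y * y 1 ^ 2) =
      (Pi.single i 1 : Plane) 1 * ∫ y in S, f y := by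
  have hm := hS.measurableSet
  have key : ∀ (j : Fin 2) (A B C : ℝ), (∀ y ∈ S, y j * fderiv ℝ f y (Pi.single i 1) =
      r y * (A * y 0 ^ 2 + B * (y 0 * y 1) + C * y 1 ^ 2)) →
      A * (∫ y in S, r y * y 0 ^ 2) + B * (∫ y in S, r y * (y 0 * y 1)) +
        C * (∫ y in S, r y * y 1 ^ 2) = -((Pi.single i 1 : Plane) j * ∫ y in S, f y) := by
    intro j A B C hj
    rw [← setIntegral_mul_quadratic hm hr hr0 hri, ← setIntegral_congr_fun hm hj]
    -- Integrability of `y j * ∂ᵢ f` comes from the equation itself: on `S` it equals `r` times a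
    -- quadratic form.
    exact setIntegral_coord_mul_fderiv hS hf0 hd hb hfi i j
      ((integrableOn_congr_fun hj hm).2 (integrableOn_mul_quadratic hm hr hr0 hri A B C))
  have k0 := key 0 (-β₀) (-β₁) 0 fun y hy => by rw [h y hy]; ring
  have k1 := key 1 0 (-β₀) (-β₁) fun y hy => by rw [h y hy]; ring
  constructor <;> linarith

theorem coeff_system (hγ : 1 < γ) (hJ : J.OrdConnected) (hJ' : J.Nontrivial) (h0 : (0 : ℝ) ∈ J)
    (hΩ : IsMaterialVolume J U Ω) (hsol : IsClassicalSolution γ l g μ J Ω ρ p U)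
    (hlin : HasLinearProfile J Ω U a b c d) (hfin : FiniteMoments Ω ρ p 0 z)
    (hne : ∃ y ∈ slice (Ω 0) z, ρ 0 (lift y z) ≠ 0)
    (hb : PressureVanishesOnBoundary J Ω p z) {t : ℝ} (ht : t ∈ J) :
    HasDerivWithinAt (fun s => a s z) (-a t z ^ 2 - b t z * c t z + l * c t z - μ z * a t z
      + Kconst Ω ρ p γ z * G2 Ω ρ γ t z) J t ∧
    HasDerivWithinAt (fun s => b s z) (-b t z * (a t z + d t z) + l * d t z - μ z * b t z
      - Kconst Ω ρ p γ z * G3 Ω ρ γ t z) J t ∧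
    HasDerivWithinAt (fun s => c s z) (-c t z * (a t z + d t z) - l * a t z - μ z * c t z
      - Kconst Ω ρ p γ z * G3 Ω ρ γ t z) J t ∧
    HasDerivWithinAt (fun s => d s z) (-d t z ^ 2 - b t z * c t z - l * b t z - μ z * d t z
      + Kconst Ω ρ p γ z * G1 Ω ρ γ t z) J t := by
  have hU := hsol.velocity_contDiffOn.differentiableOn one_ne_zero
  obtain ⟨M, hM⟩ := exists_isLinearFlow hJ h0 hΩ hU hlin ⟨_, hne.choose_spec.1⟩
  have hnet : (slice (Ω t) z).Nonempty := by
    rw [hM.slice_eq t ht]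
    exact Set.Nonempty.image _ ⟨_, hne.choose_spec.1⟩
  obtain ⟨hΔ, hE⟩ := Delta_pos_and_Ep_eq hJ hJ' h0 hΩ hsol hlin hfin hne ht
  obtain ⟨hft, -⟩ := functionals_transport hJ hJ' h0 hΩ hsol hlin hM hfin ht
  obtain ⟨da, db, dc, dd⟩ := differentiableWithinAt_coeff hΩ.isOpen hU hlin ht hnet
  obtain ⟨a', da⟩ : ∃ a', HasDerivWithinAt (fun s => a s z) a' J t :=
    ⟨_, da.hasDerivWithinAt⟩
  obtain ⟨b', db⟩ : ∃ b', HasDerivWithinAt (fun s => b s z) b' J t :=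
    ⟨_, db.hasDerivWithinAt⟩
  obtain ⟨c', dc⟩ : ∃ c', HasDerivWithinAt (fun s => c s z) c' J t :=
    ⟨_, dc.hasDerivWithinAt⟩
  obtain ⟨d', dd⟩ : ∃ d', HasDerivWithinAt (fun s => d s z) d' J t :=
    ⟨_, dd.hasDerivWithinAt⟩
  have hmom := fun y (hy : y ∈ slice (Ω t) z) => horizontal_momentum
    (uniqueDiffOn_of_ordConnected_of_nontrivial hJ hJ') hΩ hsol hlin ht da db dc dd hy
  have hpd : ∀ y ∈ slice (Ω t) z, DifferentiableAt ℝ (p t) (lift y z) := fun y hy =>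
    differentiableAt_space hΩ.isOpen (hsol.pressure_contDiffOn.differentiableOn one_ne_zero) ht hy
  have hS := isOpen_slice (isOpen_of_spaceTime hΩ.isOpen ht) z
  have hfd : ∀ y ∈ slice (Ω t) z, DifferentiableAt ℝ (fun y => p t (lift y z)) y := fun y hy =>
    DifferentiableAt.comp (g := p t) y (hpd y hy) (hasFDerivAt_lift z y).differentiableAt
  obtain ⟨m00, m01⟩ := momentum_moments hS (fun y hy => hsol.pressure_nonneg t ht _ hy) hfd
    (hb t ht) hft.2 (density_continuousOn hΩ hsol ht) (fun y hy => hsol.density_nonneg t ht _ hy)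
    hft.1 (i := 0) fun y hy => ((fderiv_comp_lift (hpd y hy)).1.trans (hmom y hy).1)
  obtain ⟨m10, m11⟩ := momentum_moments hS (fun y hy => hsol.pressure_nonneg t ht _ hy) hfd
    (hb t ht) hft.2 (density_continuousOn hΩ hsol ht) (fun y hy => hsol.density_nonneg t ht _ hy)
    hft.1 (i := 1) fun y hy => ((fderiv_comp_lift (hpd y hy)).2.trans (hmom y hy).2)
  have hP : (∫ y in slice (Ω t) z, p t (lift y z)) = (γ - 1) * Ep Ω p γ t z := by
    rw [Ep]
    field_simp [sub_ne_zero.2 hγ.ne']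
  have i1 : (∫ y in slice (Ω t) z, ρ t (lift y z) * y 0 ^ 2) = 2 * Gx1 Ω ρ t z := by
    rw [Gx1]; ring
  have i2 : (∫ y in slice (Ω t) z, ρ t (lift y z) * y 1 ^ 2) = 2 * Gx2 Ω ρ t z := by
    rw [Gx2]; ring
  have i3 : (∫ y in slice (Ω t) z, ρ t (lift y z) * (y 0 * y 1)) = 2 * Gx1x2 Ω ρ t z := by
    rw [Gx1x2]; ring
  -- The adiabatic relation turns `∫ p` into `2 K Δ ^ (-(γ + 1) / 2) Δ`; the first power of `Δ` is
  -- the normalization in `G1`, `G2`, `G3`, and the last factor cancels the determinant in Cramer's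
  -- rule.
  have hK : (γ - 1) * Ep Ω p γ t z =
      2 * Kconst Ω ρ p γ z * Delta Ω ρ t z ^ (-(γ + 1) / 2) * Delta Ω ρ t z := by
    rw [hE, show (-γ + 1) / 2 = -(γ + 1) / 2 + 1 by ring, Real.rpow_add_one hΔ.ne', Kconst]
    ring
  rw [hP, i1, i3, hK] at m00 m10
  rw [hP, i3, i2, hK] at m01 m11
  simp only [Pi.single_eq_same, ne_eq, one_ne_zero, zero_ne_one, not_false_eq_true,
    Pi.single_eq_of_ne, one_mul, zero_mul] at m00 m01 m10 m11
  have hΔ' := Delta.eq_1 Ω ρ t z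
  refine ⟨da.congr_deriv ?_, db.congr_deriv ?_, dc.congr_deriv ?_, dd.congr_deriv ?_⟩ <;>
    -- Cramer's rule: after multiplication by `Δ`, each bracket with one time derivative is a
    -- combination of two moment identities weighted by the cofactors.
    apply mul_right_cancel₀ hΔ.ne' <;> simp only [G1, G2, G3]
  · linear_combination (Gx2 Ω ρ t z / 2) * m00 - (Gx1x2 Ω ρ t z / 2) * m01 +
      (a' + a t z ^ 2 + b t z * c t z - l * c t z + μ z * a t z) * hΔ'
  · linear_combination (Gx1 Ω ρ t z / 2) * m01 - (Gx1x2 Ω ρ t z / 2) * m00 +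
      (b' + b t z * (a t z + d t z) - l * d t z + μ z * b t z) * hΔ'
  · linear_combination (Gx2 Ω ρ t z / 2) * m10 - (Gx1x2 Ω ρ t z / 2) * m11 +
      (c' + c t z * (a t z + d t z) + l * a t z + μ z * c t z) * hΔ'
  · linear_combination (Gx1 Ω ρ t z / 2) * m11 - (Gx1x2 Ω ρ t z / 2) * m10 +
      (d' + d t z ^ 2 + b t z * c t z + l * b t z + μ z * d t z) * hΔ'

/-- The weight `Δ ^ (-(γ + 1) / 2)` has logarithmic derivative `-(γ + 1) (a + d)`, which is added to
the rates of the raw moments. -/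
theorem normalized_moments_system (hJ : J.OrdConnected) (hJ' : J.Nontrivial) (h0 : (0 : ℝ) ∈ J)
    (hΩ : IsMaterialVolume J U Ω) (hsol : IsClassicalSolution γ l g μ J Ω ρ p U)
    (hlin : HasLinearProfile J Ω U a b c d) (hfin : FiniteMoments Ω ρ p 0 z)
    {t : ℝ} (ht : t ∈ J) (hΔ : 0 < Delta Ω ρ t z) :
    HasDerivWithinAt (fun s => G1 Ω ρ γ s z)
      (((1 - γ) * a t z - (1 + γ) * d t z) * G1 Ω ρ γ t z + 2 * b t z * G3 Ω ρ γ t z) J t ∧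
    HasDerivWithinAt (fun s => G2 Ω ρ γ s z)
      (((1 - γ) * d t z - (1 + γ) * a t z) * G2 Ω ρ γ t z + 2 * c t z * G3 Ω ρ γ t z) J t ∧
    HasDerivWithinAt (fun s => G3 Ω ρ γ s z)
      (c t z * G1 Ω ρ γ t z + b t z * G2 Ω ρ γ t z
        - γ * (a t z + d t z) * G3 Ω ρ γ t z) J t := by
  obtain ⟨-, h1, h2, h3, -, hD⟩ := moments_hasDerivWithinAt hJ hJ' h0 hΩ hsol hlin hfin ht
  have hw : HasDerivWithinAt (fun s => Delta Ω ρ s z ^ (-(γ + 1) / 2))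
      (-(γ + 1) * (a t z + d t z) * Delta Ω ρ t z ^ (-(γ + 1) / 2)) J t := by
    refine (hD.rpow_const (.inl hΔ.ne')).congr_deriv ?_
    rw [Real.rpow_sub_one hΔ.ne']
    field_simp
  refine ⟨(h1.mul hw).congr_deriv ?_, (h2.mul hw).congr_deriv ?_, (h3.mul hw).congr_deriv ?_⟩ <;>
  · simp only [G1, G2, G3]
    ring

end ClosedSystem

end Vortex

/-! ### Assembly of the theorem. -/

theorem mainTheorem5
    (γ l g : ℝ) (hγ : 1 < γ) (μ : ℝ → ℝ)
    (J : Set ℝ) (hJ : J.OrdConnected) (hJ' : J.Nontrivial) (h0 : (0 : ℝ) ∈ J)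
    (Ω : ℝ → Set Vortex.Space) (ρ p : ℝ → Vortex.Space → ℝ)
    (U : ℝ → Vortex.Space → Vortex.Space) (a b c d : ℝ → ℝ → ℝ)
    (hΩ : Vortex.IsMaterialVolume J U Ω)
    (hsol : Vortex.IsClassicalSolution γ l g μ J Ω ρ p U)
    (hlin : Vortex.HasLinearProfile J Ω U a b c d)
    (z : ℝ) (hfin : Vortex.FiniteMoments Ω ρ p 0 z) :
    -- the equations for the second moments, the potential energy and `Δ`
    (∀ t ∈ J,
      Vortex.FiniteMoments Ω ρ p t z ∧
      HasDerivWithinAt (fun s => Vortex.Gx1 Ω ρ s z)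
        (2 * a t z * Vortex.Gx1 Ω ρ t z + 2 * b t z * Vortex.Gx1x2 Ω ρ t z) J t ∧
      HasDerivWithinAt (fun s => Vortex.Gx2 Ω ρ s z)
        (2 * d t z * Vortex.Gx2 Ω ρ t z + 2 * c t z * Vortex.Gx1x2 Ω ρ t z) J t ∧
      HasDerivWithinAt (fun s => Vortex.Gx1x2 Ω ρ s z)
        ((a t z + d t z) * Vortex.Gx1x2 Ω ρ t z + b t z * Vortex.Gx2 Ω ρ t z
          + c t z * Vortex.Gx1 Ω ρ t z) J t ∧
      HasDerivWithinAt (fun s => Vortex.Ep Ω p γ s z)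
        (-(γ - 1) * (a t z + d t z) * Vortex.Ep Ω p γ t z) J t ∧
      HasDerivWithinAt (fun s => Vortex.Delta Ω ρ s z)
        (2 * (a t z + d t z) * Vortex.Delta Ω ρ t z) J t) ∧
    -- nontrivial solutions
    ((∃ y ∈ Vortex.slice (Ω 0) z, ρ 0 (Vortex.lift y z) ≠ 0) →
      (∀ t ∈ J,
        0 < Vortex.Delta Ω ρ t z ∧
        Vortex.Ep Ω p γ t z =
          Vortex.Ep Ω p γ 0 z * Vortex.Delta Ω ρ 0 z ^ ((γ - 1) / 2)
            * Vortex.Delta Ω ρ t z ^ ((-γ + 1) / 2)) ∧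
      (Vortex.PressureVanishesOnBoundary J Ω p z →
        Vortex.SolvesFullSystem γ l (μ z) (Vortex.Kconst Ω ρ p γ z) J
          (fun t => Vortex.G1 Ω ρ γ t z) (fun t => Vortex.G2 Ω ρ γ t z)
          (fun t => Vortex.G3 Ω ρ γ t z)
          (fun t => a t z) (fun t => b t z) (fun t => c t z) (fun t => d t z))) ∧
    -- the closed system is the system of the exact solutions of the barotropic model
    (∀ (κ K : ℝ) (g₁ g₂ g₃ α β η δ : ℝ → ℝ),
      (Vortex.SolvesFullSystem γ l κ K J g₁ g₂ g₃ α β η δ ↔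
        Vortex.SolvesMatrixSystem γ l κ (K / 2) J
          (fun t => Vortex.mat (α t) (β t) (η t) (δ t))
          (fun t => Vortex.mat (-g₂ t) (g₃ t) (g₃ t) (-g₁ t))) ∧
      (Vortex.SolvesFullSystem γ l κ K J g₁ g₂ g₃ α β η δ ↔
        Vortex.SolvesBarotropic γ l κ (K / 2) J
          (fun t x => (Vortex.mat (α t) (β t) (η t) (δ t)).mulVec x)
          (fun t x => -g₂ t * x 0 ^ 2 + 2 * g₃ t * (x 0 * x 1) + -g₁ t * x 1 ^ 2))) := by
  refine ⟨fun t ht => Vortex.moments_hasDerivWithinAt hJ hJ' h0 hΩ hsol hlin hfin ht,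
    fun hne => ?_, fun κ K g₁ g₂ g₃ α β η δ =>
      ⟨Vortex.solvesFullSystem_iff_solvesMatrixSystem γ l κ K J g₁ g₂ g₃ α β η δ,
        Vortex.solvesFullSystem_iff_solvesBarotropic γ l κ K J g₁ g₂ g₃ α β η δ⟩⟩
  have hΔ := fun t (ht : t ∈ J) =>
    Vortex.Delta_pos_and_Ep_eq hJ hJ' h0 hΩ hsol hlin hfin hne ht
  refine ⟨hΔ, fun hb => ?_⟩
  have hG := fun t (ht : t ∈ J) => Vortex.normalized_moments_system (γ := γ) hJ hJ' h0 hΩ hsol hlin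
    hfin ht (hΔ t ht).1
  have hc := fun t (ht : t ∈ J) =>
    Vortex.coeff_system hγ hJ hJ' h0 hΩ hsol hlin hfin hne hb ht
  exact ⟨fun t ht => (hG t ht).1, fun t ht => (hG t ht).2.1, fun t ht => (hG t ht).2.2,
    fun t ht => (hc t ht).1, fun t ht => (hc t ht).2.1, fun t ht => (hc t ht).2.2.1,
    fun t ht => (hc t ht).2.2.2⟩
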